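/- For $N\ge 1$ let $\lambda_1,\dots,\lambda_N\in\mathbb R$ be the eigenvalues of the $N\times N$ Gaussian unitary ensemble with weight $e^{-x^2}$, that is, random variables with joint probability density $$\frac1{Z_N}\prod_{j=1}^N e^{-\lambda_j^2}\prod_{1\le j<k\le N}(\lambda_k-\lambda_j)^2 ,$$ and let $\langle\,\cdot\,\rangle$ denote the corresponding average. For functions $A,B$ of the eigenvalues put $\mathrm{Cov}(A,B)=\langle (A-\langle A\rangle)(B-\langle B\rangle)\rangle$ (no complex conjugation), and for $k\in\mathbb R$ let $$\bar S_N(k)=\Big\langle\Big|\sum_{j=1}^N e^{ik\lambda_j}\Big|^2\Big\rangle-\Big|\Big\langle\sum_{j=1}^N e^{ik\lambda_j}\Big\rangle\Big|^2$$ be the averaged structure function. Let $J_n(x)=\sum_{m\ge 0}\frac{(-1)^m}{m!\,(m+n)!}\left(\frac x2\right)^{2m+n}$ be the Bessel function of the first kind. (1) For every real $\tau\neq 0$, $$\lim_{N\to\infty}\frac1N\Big\langle\sum_{j=1}^N e^{i\tau\lambda_j/\sqrt{2N}}\Big\rangle=\frac{2J_1(\tau)}{\tau}.$$ (2) For every real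 $\tau\ne0$, $$\lim_{N\to\infty}\bar S_N\big(\tau/\sqrt{2N}\big)=\frac{\tau^2}{2}\Big(J_0(\tau)^2+J_1(\tau)^2-\frac{J_0(\tau)J_1(\tau)}{\tau}\Big).$$ (3) For all real $\tau_1,\tau_2$ with $\tau_1+\tau_2\neq0$, $$\lim_{N\to\infty}\mathrm{Cov}\Big(\sum_{j=1}^N e^{i\tau_1\lambda_j/\sqrt{2N}},\ \sum_{j=1}^N e^{i\tau_2\lambda_j/\sqrt{2N}}\Big)=-\frac{\tau_1\tau_2}{2(\tau_1+\tau_2)}\Big(J_0(\tau_1)J_1(\tau_2)+J_1(\tau_1)J_0(\tau_2)\Big).$$ In each of the three cases, for fixed values of the parameters $\tau$, respectively $\tau_1,\tau_2$, the difference between the quantity at $N$ and its limit is $O(1/N^2)$ as $N\to\infty$. -/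

import Mathlib

open MeasureTheory Filter Topology Asymptotics

noncomputable section

/-- The Bessel function of the first kind `J_n`, of integer order `n ≥ 0`, on the real line. -/
def besselJ (n : ℕ) (x : ℝ) : ℝ :=
  ∑' m : ℕ, (-1 : ℝ) ^ m / ((m.factorial : ℝ) * ((m + n).factorial : ℝ)) * (x / 2) ^ (2 * m + n)

/-- The series defining `besselJ` converges (absolutely) everywhere. -/
theorem besselJ_summable (n : ℕ) (x : ℝ) :
    Summable fun m : ℕ =>
      (-1 : ℝ) ^ m / ((m.factorial : ℝ) * ((m + n).factorial : ℝ)) * (x / 2) ^ (2 * m + n) := by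
  have h := (Real.summable_pow_div_factorial ((x / 2) ^ 2)).mul_left (|x / 2| ^ n)
  refine Summable.of_norm_bounded h fun m => ?_
  have h1 : (1 : ℝ) ≤ ((m + n).factorial : ℝ) := by exact_mod_cast Nat.factorial_pos _
  have h2 : (0 : ℝ) < (m.factorial : ℝ) := by exact_mod_cast Nat.factorial_pos _
  rw [norm_mul, norm_div, norm_pow, norm_neg, norm_one, one_pow, norm_pow, Real.norm_eq_abs,
    Real.norm_eq_abs, abs_of_pos (by positivity), pow_add, pow_mul, sq_abs]
  have h3 : 1 / ((m.factorial : ℝ) * ((m + n).factorial : ℝ)) ≤ 1 / (m.factorial : ℝ) :=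
    one_div_le_one_div_of_le h2 (le_mul_of_one_le_right h2.le h1)
  calc 1 / ((m.factorial : ℝ) * ((m + n).factorial : ℝ)) * (((x / 2) ^ 2) ^ m * |x / 2| ^ n)
      ≤ 1 / (m.factorial : ℝ) * (((x / 2) ^ 2) ^ m * |x / 2| ^ n) := by gcongr
    _ = _ := by ring

namespace GUE

/-- The unnormalised joint eigenvalue density of the `N × N` GUE with weight `exp (-x ^ 2)`:
`∏ i, exp (-(x i) ^ 2) * ∏ i < j, (x j - x i) ^ 2`. -/
def weight (N : ℕ) (x : Fin N → ℝ) : ℝ :=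
  (∏ i, Real.exp (-(x i) ^ 2)) * ∏ i, ∏ j ∈ Finset.Ioi i, (x j - x i) ^ 2

/-- The normalisation constant of the joint eigenvalue density. -/
def partitionFunction (N : ℕ) : ℝ :=
  ∫ x : Fin N → ℝ, weight N x

/-- The joint law of the eigenvalues of the `N × N` GUE. -/
def eigenvalueLaw (N : ℕ) : Measure (Fin N → ℝ) :=
  volume.withDensity fun x => ENNReal.ofReal (weight N x / partitionFunction N)

theorem weight_nonneg (N : ℕ) (x : Fin N → ℝ) : 0 ≤ weight N x := by
  unfold weight; positivity

theorem weight_continuous (N : ℕ) : Continuous (weight N) := by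
  unfold weight; fun_prop

theorem weight_integrable (N : ℕ) : Integrable (weight N) := by
  have h1 : Integrable fun t : ℝ => 2 ^ N * (1 + t ^ 2) ^ (2 * N) * Real.exp (-t ^ 2) := by
    have h2 : ∀ k : ℕ, Integrable fun t : ℝ => t ^ k * Real.exp (-t ^ 2) := by
      intro k
      have h := integrable_rpow_mul_exp_neg_mul_sq (b := 1) one_pos (s := (k : ℝ))
        (by have : (0 : ℝ) ≤ k := Nat.cast_nonneg k
            linarith)
      simpa using h
    have h3 : (fun t : ℝ => 2 ^ N * (1 + t ^ 2) ^ (2 * N) * Real.exp (-t ^ 2)) =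
        fun t : ℝ => ∑ k ∈ Finset.range (2 * N + 1),
          (2 ^ N * ((2 * N).choose k : ℝ)) * (t ^ (2 * (2 * N - k)) * Real.exp (-t ^ 2)) := by
      funext t
      rw [add_pow, Finset.mul_sum, Finset.sum_mul]
      refine Finset.sum_congr rfl fun k _ => ?_
      rw [one_pow, ← pow_mul]
      ring
    rw [h3]
    exact integrable_finsetSum _ fun k _ => (h2 _).const_mul _
  have h4 := Integrable.fintype_prod (ι := Fin N) (μ := fun _ => (volume : Measure ℝ))
    (f := fun _ t => 2 ^ N * (1 + t ^ 2) ^ (2 * N) * Real.exp (-t ^ 2)) fun _ => h1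
  refine h4.mono' (weight_continuous N).aestronglyMeasurable (Eventually.of_forall fun x => ?_)
  rw [Real.norm_of_nonneg (weight_nonneg N x), Finset.prod_mul_distrib, mul_comm]
  unfold weight
  refine mul_le_mul_of_nonneg_left ?_ (Finset.prod_nonneg fun _ _ => (Real.exp_pos _).le)
  have h5 : ∀ i j : Fin N, (x j - x i) ^ 2 ≤ 2 * (1 + x i ^ 2) * (1 + x j ^ 2) := by
    intro i j
    nlinarith [sq_nonneg (x i + x j), sq_nonneg (x i * x j)]
  have h6 : ∀ i j : Fin N, 1 ≤ 2 * (1 + x i ^ 2) * (1 + x j ^ 2) := by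
    intro i j
    nlinarith [sq_nonneg (x i), sq_nonneg (x j), mul_nonneg (sq_nonneg (x i)) (sq_nonneg (x j))]
  calc ∏ i, ∏ j ∈ Finset.Ioi i, (x j - x i) ^ 2
      ≤ ∏ i, ∏ j ∈ Finset.Ioi i, 2 * (1 + x i ^ 2) * (1 + x j ^ 2) := by
        gcongr with i _ j _
        exact h5 i j
    _ ≤ ∏ i, ∏ j, 2 * (1 + x i ^ 2) * (1 + x j ^ 2) := by
        refine Finset.prod_le_prod (fun i _ => by positivity) fun i _ => ?_
        rw [← Finset.prod_subset (Finset.subset_univ (Finset.Ioi i))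
          (f := fun j => if j ∈ Finset.Ioi i then 2 * (1 + x i ^ 2) * (1 + x j ^ 2) else 1)
          (fun j _ hj => if_neg hj) |>.symm.trans
            (Finset.prod_congr rfl fun j hj => if_pos hj)]
        refine Finset.prod_le_prod (fun j _ => by positivity) fun j _ => ?_
        split_ifs
        exacts [le_rfl, h6 i j]
    _ = ∏ i, 2 ^ N * (1 + x i ^ 2) ^ (2 * N) := by
        simp only [Finset.prod_mul_distrib, Finset.prod_const, Finset.card_univ, Fintype.card_fin]
        rw [mul_assoc, Finset.prod_pow, Finset.prod_pow, two_mul N, pow_add]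

theorem partitionFunction_pos (N : ℕ) : 0 < partitionFunction N := by
  unfold partitionFunction
  rw [integral_pos_iff_support_of_nonneg (weight_nonneg N) (weight_integrable N)]
  refine (weight_continuous N).isOpen_support.measure_pos _ ⟨fun i => (i : ℝ), ?_⟩
  rw [Function.mem_support]
  unfold weight
  refine mul_ne_zero (Finset.prod_ne_zero_iff.2 fun _ _ => (Real.exp_pos _).ne')
    (Finset.prod_ne_zero_iff.2 fun i _ => Finset.prod_ne_zero_iff.2 fun j hj => ?_)
  have hij : i < j := Finset.mem_Ioi.1 hj
  have h : (i : ℕ) < (j : ℕ) := hij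
  have h' : ((i : ℕ) : ℝ) < ((j : ℕ) : ℝ) := by exact_mod_cast h
  exact pow_ne_zero _ (sub_pos.2 h').ne'

instance eigenvalueLaw_isProbabilityMeasure (N : ℕ) :
    IsProbabilityMeasure (eigenvalueLaw N) := by
  refine ⟨?_⟩
  unfold eigenvalueLaw
  rw [withDensity_apply _ MeasurableSet.univ, Measure.restrict_univ,
    ← ofReal_integral_eq_lintegral_ofReal ((weight_integrable N).div_const _)
      (Eventually.of_forall fun x =>
        div_nonneg (weight_nonneg N x) (partitionFunction_pos N).le),
    integral_div]
  change ENNReal.ofReal (partitionFunction N / partitionFunction N) = 1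
  rw [div_self (partitionFunction_pos N).ne', ENNReal.ofReal_one]

/-- The ensemble average `⟨A⟩` of a complex-valued function of the eigenvalues. -/
def average (N : ℕ) (A : (Fin N → ℝ) → ℂ) : ℂ :=
  ∫ x, A x ∂(eigenvalueLaw N)

/-- The covariance `⟨(A - ⟨A⟩) (B - ⟨B⟩)⟩`, without complex conjugation. -/
def cov (N : ℕ) (A B : (Fin N → ℝ) → ℂ) : ℂ :=
  average N fun x => (A x - average N A) * (B x - average N B)

/-- The linear statistic `∑ j, exp (i k λ_j)`. -/
def expSum (N : ℕ) (k : ℝ) (x : Fin N → ℝ) : ℂ :=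
  ∑ j, Complex.exp (Complex.I * (k : ℂ) * (x j : ℂ))

/-- The averaged structure function `⟨|∑ j, exp (i k λ_j)| ^ 2⟩ - |⟨∑ j, exp (i k λ_j)⟩| ^ 2`. -/
def structureFunction (N : ℕ) (k : ℝ) : ℝ :=
  (∫ x, ‖expSum N k x‖ ^ 2 ∂(eigenvalueLaw N)) - ‖average N (expSum N k)‖ ^ 2

end GUE

end

/-! Expanding the squared Vandermonde factor in Hermite polynomials orthonormal for `exp (-x ^ 2)`
turns every average into matrix elements `m_{jk}(t)` of multiplication by `exp (i t x)`. With `P`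
the projection onto the first `N` Hermite functions, the mean is `tr P e^{ikx}`, and the covariance
is `tr P e^{i(k₁+k₂)x} - tr (P e^{ik₁x} P e^{ik₂x})`, by `average_expSum` and `cov_expSum`.

The rest is exact algebra at finite `N`. The commutator of the lowering operator with `e^{itx}`
(`matrixElement_commutator`) makes these traces telescope, so that only elements at the edge of the
truncation, with indices `N - 1` and `N`, survive. At `t = τ / √(2N)`, let `p` be the mean of the
two diagonal edge elements and `r` be `-i` times the off-diagonal one. Then `p' = -(1 - ε τ²) r` and
`(τ r)' = τ p` with `ε = 1 / (16 N²)` (`hasDerivAt_scaledDiag`, `hasDerivAt_mul_scaledOffDiag`). For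
`ε = 0` this is the system solved by `J₀, J₁`; an energy estimate (`norm_sub_besselJ_le`) gives `p =
J₀ + O(ε)` and `r = J₁ + O(ε)`, which explains the rate `1/N²`. The mean is exactly `2 r / τ` after
division by `N`.

For the covariance `C`, move along a line `τ₁ + τ₂ = s`: the derivative of `s C` is an explicit
expression in `p, r` (`hasDerivAt_mul_scaledCov`), which `symmetricPair` cancels up to a term
proportional to `ε s` (`norm_mul_add_symmetricPair_le`). Since `C` vanishes when one argument is
zero, `C = -symmetricPair / s + O(ε)`. The error stays bounded after division by `s`, so letting `s
→ 0` yields the structure function, which is `C(τ, -τ)` (`norm_add_diagonal_le`). -/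

namespace GUE

/-! ### Hermite polynomials orthonormal for the weight `exp (-x ^ 2)` -/

/-- The monic Hermite polynomials for the weight `exp (-x ^ 2)`. -/
noncomputable def monicHermite : ℕ → Polynomial ℝ
  | 0 => 1
  | n + 1 => Polynomial.X * monicHermite n -
      Polynomial.C (1 / 2) * Polynomial.derivative (monicHermite n)

/-- The leading coefficients of the orthonormal Hermite polynomials. -/
noncomputable def hermiteLead : ℕ → ℝ
  | 0 => (√(√Real.pi))⁻¹
  | n + 1 => √2 / √((n : ℝ) + 1) * hermiteLead n

/-- The Hermite polynomials, orthonormal for the weight `exp (-x ^ 2)`. -/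
noncomputable def hermite (n : ℕ) : Polynomial ℝ :=
  Polynomial.C (hermiteLead n) * monicHermite n

theorem hermiteLead_ne_zero (n : ℕ) : hermiteLead n ≠ 0 := by
  induction n with
  | zero =>
    have := Real.pi_pos
    unfold hermiteLead
    positivity
  | succ n ih =>
    unfold hermiteLead
    have : (0 : ℝ) < (n : ℝ) + 1 := by positivity
    positivity

theorem monicHermite_monic_natDegree (n : ℕ) :
    (monicHermite n).Monic ∧ (monicHermite n).natDegree = n := by
  induction n with
  | zero => simp [monicHermite]
  | succ n ih =>
    obtain ⟨h1, h2⟩ := ih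
    have h3 : (Polynomial.X * monicHermite n).Monic := Polynomial.monic_X.mul h1
    have h4 : (Polynomial.X * monicHermite n).natDegree = n + 1 := by
      rw [Polynomial.natDegree_X_mul h1.ne_zero, h2]
    have h5 : (Polynomial.C (1 / 2 : ℝ) * Polynomial.derivative (monicHermite n)).degree <
        (Polynomial.X * monicHermite n).degree := by
      rw [Polynomial.degree_eq_natDegree h3.ne_zero, h4]
      rw [Polynomial.degree_C_mul (by norm_num)]
      refine lt_of_le_of_lt Polynomial.degree_derivative_le ?_
      rw [Polynomial.degree_eq_natDegree h1.ne_zero, h2]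
      exact_mod_cast Nat.lt_succ_self n
    refine ⟨?_, ?_⟩
    · unfold monicHermite
      exact h3.sub_of_left h5
    · unfold monicHermite
      rw [Polynomial.natDegree_sub_eq_left_of_natDegree_lt, h4]
      rw [h4, Nat.lt_succ_iff]
      exact (Polynomial.natDegree_C_mul_le _ _).trans
        ((Polynomial.natDegree_derivative_le _).trans (by omega))

theorem derivative_monicHermite (n : ℕ) :
    Polynomial.derivative (monicHermite n) = Polynomial.C (n : ℝ) * monicHermite (n - 1) := by
  induction n with
  | zero => simp [monicHermite]
  | succ n ih =>
    -- This is the Hermite differential equation: by the induction hypothesis, its right side is `n`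
    -- times the defining recursion for index `n`.
    have h1 : Polynomial.C (n : ℝ) * monicHermite n =
        Polynomial.X * Polynomial.derivative (monicHermite n) -
          Polynomial.C (1 / 2) *
            Polynomial.derivative (Polynomial.derivative (monicHermite n)) := by
      rw [ih]
      cases n with
      | zero => simp
      | succ n =>
        rw [Nat.add_sub_cancel]
        conv_lhs => rw [monicHermite]
        rw [Polynomial.derivative_mul, Polynomial.derivative_C]
        ring
    conv_lhs => rw [monicHermite]
    rw [Polynomial.derivative_sub, Polynomial.derivative_mul, Polynomial.derivative_mul,
      Polynomial.derivative_X, Polynomial.derivative_C, Nat.add_sub_cancel]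
    push_cast
    rw [Polynomial.C_add, Polynomial.C_1, add_mul, h1]
    ring

theorem derivative_hermite (n : ℕ) :
    Polynomial.derivative (hermite n) = Polynomial.C (√2 * √(n : ℝ)) * hermite (n - 1) := by
  cases n with
  | zero => simp [hermite, monicHermite]
  | succ n =>
    have h0 : √((n : ℝ) + 1) ≠ 0 := by positivity
    have h1 : hermiteLead (n + 1) * ((n : ℝ) + 1) = √2 * √((n : ℝ) + 1) * hermiteLead n := by
      rw [hermiteLead]
      field_simp
      rw [Real.sq_sqrt (by positivity)]
    unfold hermite
    rw [Polynomial.derivative_mul, Polynomial.derivative_C, derivative_monicHermite,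
      Nat.add_sub_cancel, zero_mul, zero_add, ← mul_assoc, ← mul_assoc, ← Polynomial.C_mul,
      ← Polynomial.C_mul]
    push_cast
    rw [h1]

/-- The defining recursion with its derivative term rewritten by `derivative_hermite`: position as
raising plus lowering operator. At `n = 0` the truncated index `n - 1` is harmless because its
coefficient is `√0`; the same convention is used throughout. -/
theorem X_mul_hermite (n : ℕ) :
    Polynomial.C √2 * (Polynomial.X * hermite n) =
      Polynomial.C √((n : ℝ) + 1) * hermite (n + 1) + Polynomial.C √(n : ℝ) * hermite (n - 1) := by
  have h0 : √((n : ℝ) + 1) ≠ 0 := by positivity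
  have h1 : √((n : ℝ) + 1) * hermiteLead (n + 1) = √2 * hermiteLead n := by
    rw [hermiteLead]
    field_simp
  have h2 : Polynomial.C √(n : ℝ) * hermite (n - 1) =
      Polynomial.C (√2 / 2) * Polynomial.derivative (hermite n) := by
    rw [derivative_hermite, ← mul_assoc, ← Polynomial.C_mul]
    congr 2
    have : √2 * √2 = (2 : ℝ) := Real.mul_self_sqrt (by norm_num)
    linear_combination (-(√(n : ℝ)) / 2) * this
  rw [h2]
  unfold hermite
  rw [← mul_assoc, ← mul_assoc (Polynomial.C √((n : ℝ) + 1)), ← Polynomial.C_mul, h1,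
    Polynomial.derivative_mul, Polynomial.derivative_C, monicHermite,
    show √2 / 2 = √2 * (1 / 2) by ring]
  simp only [Polynomial.C_mul]
  ring

/-! ### Fourier transforms of polynomials against the Gaussian weight -/

/-- The Fourier transform of `f (x) exp (-x ^ 2)`. -/
noncomputable def gaussFourier (f : Polynomial ℝ) (t : ℝ) : ℂ :=
  ∫ x : ℝ, Complex.exp (Complex.I * t * x) * ((f.eval x * Real.exp (-x ^ 2) : ℝ) : ℂ)

theorem integrable_eval_mul_exp (f : Polynomial ℝ) :
    Integrable fun x : ℝ => f.eval x * Real.exp (-x ^ 2) := by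
  have h2 : ∀ k : ℕ, Integrable fun t : ℝ => t ^ k * Real.exp (-t ^ 2) := by
    intro k
    have h := integrable_rpow_mul_exp_neg_mul_sq (b := 1) one_pos (s := (k : ℝ))
      (by have : (0 : ℝ) ≤ k := Nat.cast_nonneg k
          linarith)
    simpa using h
  simp only [Polynomial.eval_eq_sum_range, Finset.sum_mul, mul_assoc]
  exact integrable_finsetSum _ fun k _ => (h2 k).const_mul _

theorem norm_exp_I_mul (t x : ℝ) : ‖Complex.exp (Complex.I * t * x)‖ = 1 := by
  rw [show Complex.I * (t : ℂ) * x = ((t * x : ℝ) : ℂ) * Complex.I by push_cast; ring,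
    Complex.norm_exp_ofReal_mul_I]

theorem integrable_exp_mul (t : ℝ) {g : ℝ → ℝ} (hg : Integrable g) :
    Integrable fun x : ℝ => Complex.exp (Complex.I * t * x) * ((g x : ℝ) : ℂ) := by
  refine hg.ofReal.bdd_mul (c := 1) ?_ (Eventually.of_forall fun x => (norm_exp_I_mul t x).le)
  exact (by fun_prop : Continuous fun x : ℝ => Complex.exp (Complex.I * t * x)).aestronglyMeasurable

theorem integrable_gaussFourier (f : Polynomial ℝ) (t : ℝ) :
    Integrable fun x : ℝ =>
      Complex.exp (Complex.I * t * x) * ((f.eval x * Real.exp (-x ^ 2) : ℝ) : ℂ) :=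
  integrable_exp_mul t (integrable_eval_mul_exp f)

theorem gaussFourier_add (f g : Polynomial ℝ) (t : ℝ) :
    gaussFourier (f + g) t = gaussFourier f t + gaussFourier g t := by
  unfold gaussFourier
  rw [← integral_add (integrable_gaussFourier f t) (integrable_gaussFourier g t)]
  congr 1 with x
  rw [Polynomial.eval_add]
  push_cast
  ring

theorem gaussFourier_C_mul (c : ℝ) (f : Polynomial ℝ) (t : ℝ) :
    gaussFourier (Polynomial.C c * f) t = c * gaussFourier f t := by
  unfold gaussFourier
  rw [← integral_const_mul]
  congr 1 with x
  rw [Polynomial.eval_mul, Polynomial.eval_C]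
  push_cast
  ring

theorem hasDerivAt_exp_I_mul (t x : ℝ) :
    HasDerivAt (fun t : ℝ => Complex.exp (Complex.I * t * x))
      (Complex.I * x * Complex.exp (Complex.I * t * x)) t := by
  have h := (((Complex.ofRealCLM.hasDerivAt (x := t)).const_mul Complex.I).mul_const (x : ℂ)).cexp
  refine h.congr_deriv ?_
  rw [Complex.ofRealCLM_apply, Complex.ofRealCLM_apply, Complex.ofReal_one]
  ring

theorem hasDerivAt_gaussFourier (f : Polynomial ℝ) (t : ℝ) :
    HasDerivAt (gaussFourier f) (Complex.I * gaussFourier (Polynomial.X * f) t) t := by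
  have h := (hasDerivAt_integral_of_dominated_loc_of_deriv_le (μ := volume) (𝕜 := ℝ) (x₀ := t)
    (s := Set.univ) (bound := fun x => ‖(Polynomial.X * f).eval x * Real.exp (-x ^ 2)‖)
    (F := fun t x => Complex.exp (Complex.I * t * x) * ((f.eval x * Real.exp (-x ^ 2) : ℝ) : ℂ))
    (F' := fun t x => Complex.I * x * Complex.exp (Complex.I * t * x) *
      ((f.eval x * Real.exp (-x ^ 2) : ℝ) : ℂ))
    univ_mem (Eventually.of_forall fun s => (integrable_gaussFourier f s).aestronglyMeasurable)
    (integrable_gaussFourier f t) ?_ ?_ (integrable_eval_mul_exp _).norm ?_).2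
  · refine h.congr_deriv ?_
    unfold gaussFourier
    rw [← integral_const_mul]
    congr 1 with x
    rw [Polynomial.eval_mul, Polynomial.eval_X]
    push_cast
    ring
  · exact (by fun_prop : Continuous fun x : ℝ => Complex.I * x * Complex.exp (Complex.I * t * x) *
      ((f.eval x * Real.exp (-x ^ 2) : ℝ) : ℂ)).aestronglyMeasurable
  · refine Eventually.of_forall fun x s _ => le_of_eq ?_
    rw [norm_mul, norm_mul, norm_mul, norm_exp_I_mul, Complex.norm_I, Polynomial.eval_mul,
      Polynomial.eval_X, mul_assoc x, norm_mul x, Complex.norm_real, Complex.norm_real]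
    ring
  · exact Eventually.of_forall fun x s _ => (hasDerivAt_exp_I_mul s x).mul_const _

/-- The derivative of `exp (i t x) f(x) exp (-x ^ 2)` integrates to zero over the line. -/
theorem gaussFourier_parts (f : Polynomial ℝ) (t : ℝ) :
    Complex.I * t * gaussFourier f t + gaussFourier (Polynomial.derivative f) t =
      2 * gaussFourier (Polynomial.X * f) t := by
  have h := integral_eq_zero_of_hasDerivAt_of_integrable
    (f := fun x : ℝ => Complex.exp (Complex.I * t * x) *
      ((f.eval x * Real.exp (-x ^ 2) : ℝ) : ℂ))
    (f' := fun x : ℝ => Complex.I * t * (Complex.exp (Complex.I * t * x) *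
        ((f.eval x * Real.exp (-x ^ 2) : ℝ) : ℂ)) +
      Complex.exp (Complex.I * t * x) *
        (((Polynomial.derivative f).eval x * Real.exp (-x ^ 2) : ℝ) : ℂ) -
      2 * (Complex.exp (Complex.I * t * x) *
        (((Polynomial.X * f).eval x * Real.exp (-x ^ 2) : ℝ) : ℂ))) ?_ ?_
    (integrable_gaussFourier f t)
  · rw [integral_sub, integral_add, integral_const_mul, integral_const_mul] at h
    · exact sub_eq_zero.1 h
    · exact (integrable_gaussFourier f t).const_mul _
    · exact integrable_gaussFourier _ t
    · exact ((integrable_gaussFourier f t).const_mul _).add (integrable_gaussFourier _ t)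
    · exact (integrable_gaussFourier _ t).const_mul _
  · intro x
    have h1 : HasDerivAt (fun x : ℝ => Complex.exp (Complex.I * t * x))
        (Complex.I * t * Complex.exp (Complex.I * t * x)) x := by
      have h := hasDerivAt_exp_I_mul x t
      convert h using 1
      · ext y; congr 1; ring
      · rw [mul_right_comm _ (x : ℂ)]
    have h2 : HasDerivAt (fun x : ℝ => f.eval x * Real.exp (-x ^ 2))
        ((Polynomial.derivative f).eval x * Real.exp (-x ^ 2) +
          f.eval x * (Real.exp (-x ^ 2) * (-(2 * x)))) x := by
      refine (f.hasDerivAt x).mul ?_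
      have := ((hasDerivAt_pow 2 x).neg).exp
      simpa using this
    refine (h1.mul h2.ofReal_comp).congr_deriv ?_
    rw [Polynomial.eval_mul, Polynomial.eval_X]
    push_cast
    ring
  · exact (((integrable_gaussFourier f t).const_mul _).add (integrable_gaussFourier _ t)).sub
      ((integrable_gaussFourier _ t).const_mul _)

/-! ### Matrix elements of `exp (i t x)` in the Hermite basis -/

/-- The matrix elements of multiplication by `exp (i t x)` in the Hermite basis. -/
noncomputable def matrixElement (j k : ℕ) (t : ℝ) : ℂ :=
  gaussFourier (hermite j * hermite k) t

theorem matrixElement_comm (j k : ℕ) (t : ℝ) : matrixElement j k t = matrixElement k j t := by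
  unfold matrixElement; rw [mul_comm]

theorem gaussFourier_X_mul_hermite (j k : ℕ) (t : ℝ) :
    (√2 : ℂ) * gaussFourier (Polynomial.X * (hermite j * hermite k)) t =
      √((j : ℝ) + 1) * matrixElement (j + 1) k t + √(j : ℝ) * matrixElement (j - 1) k t := by
  have h : Polynomial.C √2 * (Polynomial.X * (hermite j * hermite k)) =
      Polynomial.C √((j : ℝ) + 1) * (hermite (j + 1) * hermite k) +
        Polynomial.C √(j : ℝ) * (hermite (j - 1) * hermite k) := by
    linear_combination hermite k * X_mul_hermite j
  have h2 := congrArg (fun f => gaussFourier f t) h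
  simp only [gaussFourier_add, gaussFourier_C_mul] at h2
  exact h2

theorem sqrt_two_mul_self : (√2 : ℂ) * (√2 : ℂ) = 2 := by
  rw [← Complex.ofReal_mul, Real.mul_self_sqrt (by norm_num)]
  simp

/-- Matrix form of `[a, e^{itx}] = (i t / √2) e^{itx}` for the lowering operator `a`: integrate by
parts and eliminate the factor `x` with the three-term recurrence. Every later telescoping rests on
it. -/
theorem matrixElement_commutator (j k : ℕ) (t : ℝ) :
    Complex.I * t * matrixElement j k t =
      √2 * (√((j : ℝ) + 1) * matrixElement (j + 1) k t - √(k : ℝ) * matrixElement j (k - 1) t) := by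
  have h1 := gaussFourier_parts (hermite j * hermite k) t
  have h2 : Polynomial.derivative (hermite j * hermite k) =
      Polynomial.C (√2 * √(j : ℝ)) * (hermite (j - 1) * hermite k) +
        Polynomial.C (√2 * √(k : ℝ)) * (hermite j * hermite (k - 1)) := by
    rw [Polynomial.derivative_mul, derivative_hermite, derivative_hermite]
    ring
  rw [h2, gaussFourier_add, gaussFourier_C_mul, gaussFourier_C_mul] at h1
  have h3 := gaussFourier_X_mul_hermite j k t
  have h4 := sqrt_two_mul_self
  simp only [Complex.ofReal_mul] at h1
  simp only [matrixElement] at *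
  linear_combination h1 + √2 * h3 - gaussFourier (Polynomial.X * (hermite j * hermite k)) t * h4

theorem hasDerivAt_matrixElement (j k : ℕ) (t : ℝ) :
    HasDerivAt (matrixElement j k) (Complex.I / √2 *
      (√((j : ℝ) + 1) * matrixElement (j + 1) k t + √(j : ℝ) * matrixElement (j - 1) k t)) t := by
  refine (hasDerivAt_gaussFourier (hermite j * hermite k) t).congr_deriv ?_
  rw [← gaussFourier_X_mul_hermite]
  have h0 : (√2 : ℂ) ≠ 0 := by
    rw [Complex.ofReal_ne_zero]; positivity
  field_simp

theorem continuous_matrixElement (j k : ℕ) : Continuous (matrixElement j k) :=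
  continuous_iff_continuousAt.2 fun t => (hasDerivAt_matrixElement j k t).continuousAt

theorem matrixElement_zero_zero : matrixElement 0 0 0 = 1 := by
  have h1 : (∫ x : ℝ, Real.exp (-x ^ 2)) = √Real.pi := by
    simpa using integral_gaussian 1
  have h2 : hermiteLead 0 * hermiteLead 0 * √Real.pi = 1 := by
    have h3 : (0 : ℝ) < √Real.pi := Real.sqrt_pos.2 Real.pi_pos
    rw [hermiteLead, ← mul_inv, Real.mul_self_sqrt h3.le, inv_mul_cancel₀ h3.ne']
  unfold matrixElement gaussFourier
  simp only [Complex.ofReal_zero, mul_zero, zero_mul, Complex.exp_zero, one_mul]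
  rw [integral_complex_ofReal]
  simp only [hermite, monicHermite, mul_one, Polynomial.eval_mul, Polynomial.eval_C]
  rw [integral_const_mul, h1, h2, Complex.ofReal_one]

/-- Orthonormality comes from the commutator at `t = 0`, which reads `√(j+1) m_{j+1,k} = √k
m_{j,k-1}`; together with symmetry it reduces everything to the Gaussian integral `m_{00} = 1`. -/
theorem matrixElement_at_zero (j k : ℕ) : matrixElement j k 0 = if j = k then 1 else 0 := by
  have hrec : ∀ j k : ℕ, (√((j : ℝ) + 1) : ℂ) * matrixElement (j + 1) k 0 =
      √(k : ℝ) * matrixElement j (k - 1) 0 := by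
    intro j k
    have h := matrixElement_commutator j k 0
    have h0 : (√2 : ℂ) ≠ 0 := by
      rw [Complex.ofReal_ne_zero]; positivity
    rw [Complex.ofReal_zero, mul_zero, zero_mul, eq_comm, mul_eq_zero] at h
    exact sub_eq_zero.1 (h.resolve_left h0)
  have hne : ∀ j : ℕ, (√((j : ℝ) + 1) : ℂ) ≠ 0 := fun j => by
    rw [Complex.ofReal_ne_zero]; positivity
  have hcol : ∀ j : ℕ, matrixElement (j + 1) 0 0 = 0 := by
    intro j
    have h := hrec j 0
    rw [Nat.cast_zero, Real.sqrt_zero, Complex.ofReal_zero, zero_mul, mul_eq_zero] at h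
    exact h.resolve_left (hne j)
  induction j generalizing k with
  | zero =>
    cases k with
    | zero => simp [matrixElement_zero_zero]
    | succ k => rw [matrixElement_comm, hcol, if_neg (by omega)]
  | succ j ih =>
    cases k with
    | zero => rw [hcol, if_neg (by omega)]
    | succ k =>
      have h := hrec j (k + 1)
      rw [Nat.add_sub_cancel, ih k] at h
      by_cases hjk : j = k
      · subst hjk
        rw [if_pos rfl, mul_one] at h
        push_cast at h
        rw [if_pos rfl]
        exact mul_left_cancel₀ (hne j) (h.trans (mul_one _).symm)
      · rw [if_neg hjk, mul_zero, mul_eq_zero] at h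
        rw [if_neg (by omega)]
        exact h.resolve_left (hne j)

theorem norm_matrixElement_le (j k : ℕ) (t : ℝ) : ‖matrixElement j k t‖ ≤ 1 := by
  have hsq : ∀ j : ℕ, (∫ x : ℝ, (hermite j * hermite j).eval x * Real.exp (-x ^ 2)) = 1 := by
    intro j
    have h := matrixElement_at_zero j j
    unfold matrixElement gaussFourier at h
    simp only [Complex.ofReal_zero, mul_zero, zero_mul, Complex.exp_zero, one_mul, if_true] at h
    rw [integral_complex_ofReal] at h
    exact_mod_cast h
  -- Pointwise `|h_j h_k| ≤ (h_j² + h_k²) / 2`, and both squares have weighted integral one.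
  have hbound : ‖matrixElement j k t‖ ≤ ∫ x : ℝ, (1 / 2 : ℝ) *
      ((hermite j * hermite j).eval x * Real.exp (-x ^ 2) +
        (hermite k * hermite k).eval x * Real.exp (-x ^ 2)) := by
    unfold matrixElement gaussFourier
    refine norm_integral_le_of_norm_le (((integrable_eval_mul_exp _).add
      (integrable_eval_mul_exp _)).const_mul _) (Eventually.of_forall fun x => ?_)
    rw [norm_mul, norm_exp_I_mul, one_mul, Complex.norm_real, norm_mul, Real.norm_eq_abs,
      Real.norm_of_nonneg (Real.exp_pos _).le, Polynomial.eval_mul, Polynomial.eval_mul,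
      Polynomial.eval_mul, ← add_mul, ← mul_assoc]
    refine mul_le_mul_of_nonneg_right ?_ (Real.exp_pos _).le
    rw [abs_le]
    constructor
    · nlinarith [sq_nonneg ((hermite j).eval x + (hermite k).eval x)]
    · nlinarith [sq_nonneg ((hermite j).eval x - (hermite k).eval x)]
  rw [integral_const_mul, integral_add (integrable_eval_mul_exp _) (integrable_eval_mul_exp _),
    hsq, hsq] at hbound
  linarith

end GUE

/-! ### Determinants of matrices that differ from the identity in at most two columns -/

/-- In the Leibniz expansion, a permutation moving some index outside `{a, b}` picks a zero entry;
only the identity and the transposition of `a` and `b` remain. -/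
theorem Matrix.det_eq_of_columns_off_pair {n R : Type*} [Fintype n] [DecidableEq n] [CommRing R]
    (A : Matrix n n R) {a b : n} (hab : a ≠ b)
    (hA : ∀ i j, j ≠ a → j ≠ b → A i j = if i = j then 1 else 0) :
    A.det = A a a * A b b - A b a * A a b := by
  rw [Matrix.det_apply]
  have hsub : ({1, Equiv.swap a b} : Finset (Equiv.Perm n)) ⊆ Finset.univ := Finset.subset_univ _
  have hoff : ∀ f : n → R, (∀ i, i ≠ a → i ≠ b → f i = 1) → ∏ i, f i = f a * f b := by
    intro f hf
    rw [← Finset.prod_pair hab]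
    refine (Finset.prod_subset (Finset.subset_univ _) fun i _ hi => ?_).symm
    simp only [Finset.mem_insert, Finset.mem_singleton, not_or] at hi
    exact hf i hi.1 hi.2
  rw [← Finset.sum_subset hsub, Finset.sum_pair]
  · rw [hoff _ fun i h1 h2 => by simp [hA i i h1 h2], hoff _ fun i h1 h2 => by
      rw [Equiv.swap_apply_of_ne_of_ne h1 h2, hA i i h1 h2, if_pos rfl]]
    rw [Equiv.swap_apply_left, Equiv.swap_apply_right, Equiv.Perm.sign_swap hab]
    simp [sub_eq_add_neg]
  · intro h
    have := congrArg (fun ρ : Equiv.Perm n => ρ a) h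
    simp only [Equiv.Perm.coe_one, id_eq, Equiv.swap_apply_left] at this
    exact hab this
  · intro ρ _ hρ
    simp only [Finset.mem_insert, Finset.mem_singleton, not_or] at hρ
    have hex : ∃ i, i ≠ a ∧ i ≠ b ∧ ρ i ≠ i := by
      by_contra hcon
      push Not at hcon
      have hmem : ∀ i, i = a ∨ i = b → ρ i = a ∨ ρ i = b := by
        intro i hi
        by_contra h
        push Not at h
        have h2 := ρ.injective (hcon _ h.1 h.2)
        rw [h2] at h
        tauto
      rcases hmem a (Or.inl rfl) with h1 | h1
      · rcases hmem b (Or.inr rfl) with h2 | h2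
        · exact hab (ρ.injective (h1.trans h2.symm))
        · refine hρ.1 (Equiv.ext fun i => ?_)
          by_cases hia : i = a
          · rw [hia, h1, Equiv.Perm.one_apply]
          by_cases hib : i = b
          · rw [hib, h2, Equiv.Perm.one_apply]
          rw [hcon i hia hib, Equiv.Perm.one_apply]
      · rcases hmem b (Or.inr rfl) with h2 | h2
        · refine hρ.2 (Equiv.ext fun i => ?_)
          by_cases hia : i = a
          · rw [hia, h1, Equiv.swap_apply_left]
          by_cases hib : i = b
          · rw [hib, h2, Equiv.swap_apply_right]
          rw [hcon i hia hib, Equiv.swap_apply_of_ne_of_ne hia hib]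
        · exact hab (ρ.injective (h1.trans h2.symm))
    obtain ⟨i, h1, h2, h3⟩ := hex
    rw [Finset.prod_eq_zero (Finset.mem_univ i), smul_zero]
    rw [hA _ _ h1 h2, if_neg h3]

theorem Matrix.det_eq_of_columns_off_single {n R : Type*} [Fintype n] [DecidableEq n] [CommRing R]
    (A : Matrix n n R) (a : n) (hA : ∀ i j, j ≠ a → A i j = if i = j then 1 else 0) :
    A.det = A a a := by
  by_cases h : ∃ b, b ≠ a
  · obtain ⟨b, hb⟩ := h
    rw [A.det_eq_of_columns_off_pair hb.symm fun i j h1 _ => hA i j h1, hA b b hb, hA a b hb,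
      if_pos rfl, if_neg hb.symm]
    ring
  · push Not at h
    have : Unique n := ⟨⟨a⟩, h⟩
    rw [Matrix.det_unique, h default]

namespace GUE

/-! ### The determinantal structure of the ensemble -/

/-- Monic polynomials of degrees `0, …, N - 1` have the same evaluation determinant as the
monomials, so the determinant is Vandermonde times the leading coefficients. -/
theorem det_hermite_sq (N : ℕ) (x : Fin N → ℝ) :
    (Matrix.of fun j i : Fin N => (hermite j).eval (x i)).det ^ 2 * ∏ i, Real.exp (-(x i) ^ 2) =
      (∏ j : Fin N, hermiteLead j) ^ 2 * weight N x := by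
  have h1 : (Matrix.of fun j i : Fin N => (hermite j).eval (x i)) =
      Matrix.of fun j i : Fin N => hermiteLead j *
        (Matrix.of fun i j : Fin N => (monicHermite j).eval (x i)).transpose j i := by
    ext j i
    simp [hermite]
  rw [h1, Matrix.det_mul_column, Matrix.det_transpose,
    ← Matrix.det_eval_matrixOfPolynomials_eq_det_vandermonde x (fun j : Fin N => monicHermite j)
      (fun j => (monicHermite_monic_natDegree j).2) (fun j => (monicHermite_monic_natDegree j).1),
    Matrix.det_vandermonde]
  unfold weight
  simp only [Finset.prod_pow]
  ring

/-- The Fourier transform of the squared Hermite determinant. -/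
noncomputable def detFourier (N : ℕ) (κ : Fin N → ℝ) : ℂ :=
  ∫ x : Fin N → ℝ, (∏ i, Complex.exp (Complex.I * κ i * x i)) *
    (((Matrix.of fun j i : Fin N => (hermite j).eval (x i)).det ^ 2 *
      ∏ i, Real.exp (-(x i) ^ 2) : ℝ) : ℂ)

/-- The Gram matrix of the Hermite functions relabelled by `σ`, twisted by `exp (i κ x)`. -/
noncomputable def twistedGram (N : ℕ) (κ : Fin N → ℝ) (σ : Equiv.Perm (Fin N)) :
    Matrix (Fin N) (Fin N) ℂ :=
  Matrix.of fun j i => matrixElement (σ i) (σ j) (κ i)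

theorem detFourier_eq (N : ℕ) (κ : Fin N → ℝ) :
    detFourier N κ = ∑ σ : Equiv.Perm (Fin N), (twistedGram N κ σ).det := by
  have hexp : ∀ x : Fin N → ℝ, (∏ i, Complex.exp (Complex.I * κ i * x i)) *
      (((Matrix.of fun j i : Fin N => (hermite j).eval (x i)).det ^ 2 *
        ∏ i, Real.exp (-(x i) ^ 2) : ℝ) : ℂ) =
      ∑ σ : Equiv.Perm (Fin N), ∑ π : Equiv.Perm (Fin N),
        ((Equiv.Perm.sign σ : ℤ) : ℂ) * ((Equiv.Perm.sign π : ℤ) : ℂ) *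
          ∏ i, (Complex.exp (Complex.I * κ i * x i) *
            (((hermite (σ i) * hermite (π i)).eval (x i) * Real.exp (-(x i) ^ 2) : ℝ) : ℂ)) := by
    intro x
    rw [Matrix.det_apply', sq, Finset.sum_mul_sum, Finset.sum_mul, Complex.ofReal_sum,
      Finset.mul_sum]
    refine Finset.sum_congr rfl fun σ _ => ?_
    rw [Finset.sum_mul, Complex.ofReal_sum, Finset.mul_sum]
    refine Finset.sum_congr rfl fun π _ => ?_
    simp only [Matrix.of_apply, Polynomial.eval_mul]
    push_cast
    simp only [Finset.prod_mul_distrib]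
    ring
  have hint : ∀ σ π : Equiv.Perm (Fin N), Integrable fun x : Fin N → ℝ =>
      ∏ i, (Complex.exp (Complex.I * κ i * x i) *
        (((hermite (σ i) * hermite (π i)).eval (x i) * Real.exp (-(x i) ^ 2) : ℝ) : ℂ)) :=
    fun σ π => Integrable.fintype_prod (ι := Fin N) (μ := fun _ => (volume : Measure ℝ))
      (f := fun (i : Fin N) (t : ℝ) => Complex.exp (Complex.I * κ i * t) *
        (((hermite (σ i) * hermite (π i)).eval t * Real.exp (-t ^ 2) : ℝ) : ℂ))
      fun i => integrable_gaussFourier _ _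
  have hval : ∀ σ π : Equiv.Perm (Fin N), (∫ x : Fin N → ℝ,
      ∏ i, (Complex.exp (Complex.I * κ i * x i) *
        (((hermite (σ i) * hermite (π i)).eval (x i) * Real.exp (-(x i) ^ 2) : ℝ) : ℂ))) =
      ∏ i, matrixElement (σ i) (π i) (κ i) :=
    fun σ π => integral_fintype_prod_volume_eq_prod (fun (i : Fin N) (t : ℝ) =>
      Complex.exp (Complex.I * κ i * t) *
        (((hermite (σ i) * hermite (π i)).eval t * Real.exp (-t ^ 2) : ℝ) : ℂ))
  unfold detFourier
  simp only [hexp]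
  rw [integral_finsetSum _ fun σ _ => integrable_finsetSum _ fun π _ => (hint σ π).const_mul _]
  refine Finset.sum_congr rfl fun σ _ => ?_
  rw [integral_finsetSum _ fun π _ => (hint σ π).const_mul _, Matrix.det_apply',
    -- Writing the second permutation as `σ ρ` cancels the sign of `σ`, and the sum over `ρ` becomes
    -- one determinant.
    ← Equiv.sum_comp (Equiv.mulLeft σ)]
  refine Finset.sum_congr rfl fun ρ _ => ?_
  rw [integral_const_mul, hval]
  simp only [Equiv.coe_mulLeft, Equiv.Perm.sign_mul, Equiv.Perm.mul_apply, twistedGram,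
    Matrix.of_apply]
  congr 1
  have h1 : ((Equiv.Perm.sign σ : ℤ) : ℂ) * ((Equiv.Perm.sign σ : ℤ) : ℂ) = 1 := by
    rw [← Int.cast_mul, Int.units_coe_mul_self, Int.cast_one]
  push_cast
  linear_combination ((Equiv.Perm.sign ρ : ℤ) : ℂ) * h1

/-- Untwisted columns are identity columns by orthonormality, so one- and two-point averages need
determinants of size at most two. -/
theorem twistedGram_apply_of_eq_zero {N : ℕ} {κ : Fin N → ℝ} (σ : Equiv.Perm (Fin N))
    {j : Fin N} (hj : κ j = 0) (i : Fin N) :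
    twistedGram N κ σ i j = if i = j then 1 else 0 := by
  rw [twistedGram, Matrix.of_apply, hj, matrixElement_at_zero]
  refine if_congr ?_ rfl rfl
  rw [Fin.val_inj, σ.injective.eq_iff, eq_comm]

theorem detFourier_zero (N : ℕ) : detFourier N 0 = (N.factorial : ℂ) := by
  rw [detFourier_eq, Finset.sum_congr rfl fun σ _ => show (twistedGram N 0 σ).det = 1 from ?_]
  · simp [Fintype.card_perm]
  · rw [← Matrix.det_one (n := Fin N)]
    congr 1
    ext i j
    rw [twistedGram_apply_of_eq_zero σ (by simp), Matrix.one_apply]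

/-! ### Ensemble averages as traces of truncated matrices -/

theorem average_eq_div (N : ℕ) (A : (Fin N → ℝ) → ℂ) :
    average N A = (∫ x, A x * ((weight N x : ℝ) : ℂ)) / (partitionFunction N : ℂ) := by
  unfold average eigenvalueLaw
  rw [integral_withDensity_eq_integral_toReal_smul
    (((weight_continuous N).measurable.div_const _).ennreal_ofReal)
    (Eventually.of_forall fun x => ENNReal.ofReal_lt_top), ← integral_div]
  congr 1 with x
  rw [ENNReal.toReal_ofReal (div_nonneg (weight_nonneg N x) (partitionFunction_pos N).le),
    Complex.real_smul]
  push_cast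
  ring

/-- The partition function need not be evaluated: dividing by the case `κ = 0`, where `detFourier`
is `N!`, cancels the leading coefficients. -/
theorem average_prod_exp (N : ℕ) (κ : Fin N → ℝ) :
    average N (fun x => ∏ i, Complex.exp (Complex.I * κ i * x i)) =
      detFourier N κ / (N.factorial : ℂ) := by
  have hL : (((∏ j : Fin N, hermiteLead j) ^ 2 : ℝ) : ℂ) ≠ 0 := by
    rw [Complex.ofReal_ne_zero]
    exact pow_ne_zero _ (Finset.prod_ne_zero_iff.2 fun j _ => hermiteLead_ne_zero j)
  have h1 : ∀ κ : Fin N → ℝ, detFourier N κ = (((∏ j : Fin N, hermiteLead j) ^ 2 : ℝ) : ℂ) *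
      ∫ x, (∏ i, Complex.exp (Complex.I * κ i * x i)) * ((weight N x : ℝ) : ℂ) := by
    intro κ
    unfold detFourier
    rw [← integral_const_mul]
    congr 1 with x
    rw [det_hermite_sq]
    push_cast
    ring
  have h2 : (∫ x, (∏ i, Complex.exp (Complex.I * ((0 : Fin N → ℝ) i : ℝ) * x i)) *
      ((weight N x : ℝ) : ℂ)) = (partitionFunction N : ℂ) := by
    simp only [Pi.zero_apply, Complex.ofReal_zero, mul_zero, zero_mul, Complex.exp_zero,
      Finset.prod_const_one, one_mul]
    rw [integral_complex_ofReal]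
    rfl
  rw [average_eq_div, ← detFourier_zero, h1 κ, h1 0, h2, mul_div_mul_left _ _ hL]

theorem integrable_prod_exp (N : ℕ) (κ : Fin N → ℝ) :
    Integrable (fun x : Fin N → ℝ => ∏ i, Complex.exp (Complex.I * κ i * x i))
      (eigenvalueLaw N) := by
  refine Integrable.of_bound (C := 1) ?_ (Eventually.of_forall fun x => ?_)
  · exact (by fun_prop : Continuous fun x : Fin N → ℝ =>
      ∏ i, Complex.exp (Complex.I * κ i * x i)).aestronglyMeasurable
  · rw [norm_prod]
    simp [norm_exp_I_mul]

theorem average_sum {N : ℕ} {ι : Type*} [Fintype ι] {f : ι → (Fin N → ℝ) → ℂ}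
    (hf : ∀ a, Integrable (f a) (eigenvalueLaw N)) :
    average N (fun x => ∑ a, f a x) = ∑ a, average N (f a) :=
  integral_finsetSum _ fun a _ => hf a

theorem prod_exp_single (N : ℕ) (a : Fin N) (k : ℝ) (x : Fin N → ℝ) :
    ∏ i, Complex.exp (Complex.I * (Pi.single a k : Fin N → ℝ) i * x i) =
      Complex.exp (Complex.I * k * x a) := by
  rw [Finset.prod_eq_single a]
  · rw [Pi.single_eq_same]
  · intro b _ hb
    rw [Pi.single_eq_of_ne hb]
    simp
  · intro h
    exact absurd (Finset.mem_univ a) h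

theorem prod_exp_single_add (N : ℕ) (a b : Fin N) (k₁ k₂ : ℝ) (x : Fin N → ℝ) :
    ∏ i, Complex.exp (Complex.I * (Pi.single a k₁ + Pi.single b k₂ : Fin N → ℝ) i * x i) =
      Complex.exp (Complex.I * k₁ * x a) * Complex.exp (Complex.I * k₂ * x b) := by
  have h := congrArg₂ (· * ·) (prod_exp_single N a k₁ x) (prod_exp_single N b k₂ x)
  simp only [← Finset.prod_mul_distrib, ← Complex.exp_add] at h
  rw [← Complex.exp_add, ← h]
  refine Finset.prod_congr rfl fun i _ => congrArg Complex.exp ?_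
  rw [Pi.add_apply, Complex.ofReal_add]
  ring

theorem integrable_expSum (N : ℕ) (k : ℝ) : Integrable (expSum N k) (eigenvalueLaw N) := by
  unfold expSum
  refine integrable_finsetSum _ fun j _ => ?_
  simpa only [prod_exp_single] using integrable_prod_exp N (Pi.single j k)

/-- The sum of the diagonal matrix elements of `exp (i k x)` over the first `N` Hermite
functions. -/
noncomputable def traceElement (N : ℕ) (k : ℝ) : ℂ :=
  ∑ j ∈ Finset.range N, matrixElement j j k

/-- The trace of the product of the truncations of `exp (i k₁ x)` and `exp (i k₂ x)` to the first
`N` Hermite functions. -/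
noncomputable def traceProduct (N : ℕ) (k₁ k₂ : ℝ) : ℂ :=
  ∑ i ∈ Finset.range N, ∑ j ∈ Finset.range N, matrixElement i j k₁ * matrixElement i j k₂

theorem sum_perm_val {N : ℕ} (σ : Equiv.Perm (Fin N)) (g : ℕ → ℂ) :
    ∑ a, g (σ a) = ∑ a ∈ Finset.range N, g a :=
  (Equiv.sum_comp σ fun a : Fin N => g a).trans (Fin.sum_univ_eq_sum_range g N)

theorem sum_detFourier_single (N : ℕ) (k : ℝ) :
    ∑ a, detFourier N (Pi.single a k) = (N.factorial : ℂ) * traceElement N k := by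
  have h : ∀ σ : Equiv.Perm (Fin N), ∑ a, (twistedGram N (Pi.single a k) σ).det =
      traceElement N k := by
    intro σ
    rw [traceElement, ← sum_perm_val σ fun j => matrixElement j j k]
    refine Finset.sum_congr rfl fun a _ => ?_
    rw [Matrix.det_eq_of_columns_off_single (twistedGram N (Pi.single a k) σ) a fun i j hj =>
      twistedGram_apply_of_eq_zero σ (Pi.single_eq_of_ne hj _) i]
    rw [twistedGram, Matrix.of_apply, Pi.single_eq_same]
  simp only [detFourier_eq]
  rw [Finset.sum_comm, Finset.sum_congr rfl fun σ _ => h σ]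
  simp [Fintype.card_perm]

theorem average_expSum (N : ℕ) (k : ℝ) : average N (expSum N k) = traceElement N k := by
  have h0 : (N.factorial : ℂ) ≠ 0 := by exact_mod_cast N.factorial_ne_zero
  have h1 : average N (expSum N k) = ∑ a, detFourier N (Pi.single a k) / (N.factorial : ℂ) := by
    simp only [← average_prod_exp]
    unfold average expSum
    rw [← integral_finsetSum _ fun a _ => integrable_prod_exp N (Pi.single a k)]
    simp only [prod_exp_single]
  rw [h1, ← Finset.sum_div, sum_detFourier_single, mul_div_cancel_left₀ _ h0]

theorem sum_detFourier_pair (N : ℕ) (k₁ k₂ : ℝ) :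
    ∑ a, ∑ b, detFourier N (Pi.single a k₁ + Pi.single b k₂) = (N.factorial : ℂ) *
      (traceElement N (k₁ + k₂) + traceElement N k₁ * traceElement N k₂ -
        traceProduct N k₁ k₂) := by
  have hdiag : ∀ a, detFourier N (Pi.single a k₁ + Pi.single a k₂) =
      detFourier N (Pi.single a (k₁ + k₂)) := by
    intro a
    rw [Pi.single_add]
  have hdet : ∀ (σ : Equiv.Perm (Fin N)) (a b : Fin N), a ≠ b →
      (twistedGram N (Pi.single a k₁ + Pi.single b k₂) σ).det =
        matrixElement (σ a) (σ a) k₁ * matrixElement (σ b) (σ b) k₂ -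
          matrixElement (σ a) (σ b) k₁ * matrixElement (σ a) (σ b) k₂ := by
    intro σ a b hab
    rw [Matrix.det_eq_of_columns_off_pair _ hab fun i j h1 h2 =>
      twistedGram_apply_of_eq_zero σ (by
        rw [Pi.add_apply, Pi.single_eq_of_ne h1, Pi.single_eq_of_ne h2, add_zero]) i]
    simp only [twistedGram, Matrix.of_apply, Pi.add_apply, Pi.single_eq_same,
      Pi.single_eq_of_ne hab, Pi.single_eq_of_ne hab.symm, add_zero, zero_add]
    rw [matrixElement_comm (σ b) (σ a)]
  -- The two-by-two determinant expression vanishes at `a = b`, so it can be summed over all pairs,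
  -- with the coincident exponentials added separately.
  have hterm : ∀ a b, detFourier N (Pi.single a k₁ + Pi.single b k₂) =
      (if a = b then detFourier N (Pi.single a (k₁ + k₂)) else 0) +
        ∑ σ : Equiv.Perm (Fin N), (matrixElement (σ a) (σ a) k₁ * matrixElement (σ b) (σ b) k₂ -
          matrixElement (σ a) (σ b) k₁ * matrixElement (σ a) (σ b) k₂) := by
    intro a b
    by_cases hab : a = b
    · subst hab
      rw [if_pos rfl, hdiag, Finset.sum_eq_zero fun σ _ => sub_self _, add_zero]
    · rw [if_neg hab, zero_add, detFourier_eq]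
      exact Finset.sum_congr rfl fun σ _ => hdet σ a b hab
  have hσ : ∀ σ : Equiv.Perm (Fin N), ∑ a, ∑ b,
      (matrixElement (σ a) (σ a) k₁ * matrixElement (σ b) (σ b) k₂ -
        matrixElement (σ a) (σ b) k₁ * matrixElement (σ a) (σ b) k₂) =
      traceElement N k₁ * traceElement N k₂ - traceProduct N k₁ k₂ := by
    intro σ
    rw [traceElement, traceElement, traceProduct, Finset.sum_mul_sum, ← Finset.sum_sub_distrib]
    simp only [← Finset.sum_sub_distrib]
    rw [← sum_perm_val σ fun a => ∑ b ∈ Finset.range N,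
      (matrixElement a a k₁ * matrixElement b b k₂ - matrixElement a b k₁ * matrixElement a b k₂)]
    refine Finset.sum_congr rfl fun a _ => ?_
    rw [← sum_perm_val σ fun b => matrixElement (σ a) (σ a) k₁ * matrixElement b b k₂ -
      matrixElement (σ a) b k₁ * matrixElement (σ a) b k₂]
  simp only [hterm, Finset.sum_add_distrib]
  rw [Finset.sum_congr rfl fun a _ => Finset.sum_ite_eq Finset.univ a _]
  simp only [Finset.mem_univ, if_true]
  rw [sum_detFourier_single]
  rw [(Finset.sum_congr rfl fun a _ => Finset.sum_comm).trans Finset.sum_comm, Finset.sum_congr rfl fun σ _ => hσ σ]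
  simp only [Finset.sum_const, Finset.card_univ, Fintype.card_perm, Fintype.card_fin, nsmul_eq_mul]
  ring

theorem average_expSum_mul (N : ℕ) (k₁ k₂ : ℝ) :
    average N (fun x => expSum N k₁ x * expSum N k₂ x) =
      traceElement N (k₁ + k₂) + traceElement N k₁ * traceElement N k₂ -
        traceProduct N k₁ k₂ := by
  have h0 : (N.factorial : ℂ) ≠ 0 := by exact_mod_cast N.factorial_ne_zero
  let f : Fin N → Fin N → (Fin N → ℝ) → ℂ := fun a b x =>
    Complex.exp (Complex.I * k₁ * x a) * Complex.exp (Complex.I * k₂ * x b)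
  have hf : ∀ a b, f a b = fun x => ∏ i, Complex.exp
      (Complex.I * (Pi.single a k₁ + Pi.single b k₂ : Fin N → ℝ) i * x i) :=
    fun a b => funext fun x => (prod_exp_single_add N a b k₁ k₂ x).symm
  have hint : ∀ a b, Integrable (f a b) (eigenvalueLaw N) := by
    intro a b
    rw [hf]
    exact integrable_prod_exp N _
  have hval : ∀ a b, average N (f a b) =
      detFourier N (Pi.single a k₁ + Pi.single b k₂) / (N.factorial : ℂ) := by
    intro a b
    rw [hf]
    exact average_prod_exp N _
  have h1 : average N (fun x => expSum N k₁ x * expSum N k₂ x) =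
      ∑ a, ∑ b, detFourier N (Pi.single a k₁ + Pi.single b k₂) / (N.factorial : ℂ) := by
    calc average N (fun x => expSum N k₁ x * expSum N k₂ x)
        = average N (fun x => ∑ a, ∑ b, f a b x) := by
          congr 1
          funext x
          exact Finset.sum_mul_sum _ _ _ _
      _ = ∑ a, average N (fun x => ∑ b, f a b x) :=
          average_sum fun a => integrable_finsetSum _ fun b _ => hint a b
      _ = ∑ a, ∑ b, average N (f a b) := Finset.sum_congr rfl fun a _ => average_sum (hint a)
      _ = _ := Finset.sum_congr rfl fun a _ => Finset.sum_congr rfl fun b _ => hval a b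
  rw [h1]
  simp only [← Finset.sum_div]
  rw [sum_detFourier_pair, mul_div_cancel_left₀ _ h0]

theorem integrable_expSum_mul (N : ℕ) (k₁ k₂ : ℝ) :
    Integrable (fun x => expSum N k₁ x * expSum N k₂ x) (eigenvalueLaw N) := by
  refine (integrable_expSum N k₂).bdd_mul (c := N) (integrable_expSum N k₁).aestronglyMeasurable
    (Eventually.of_forall fun x => ?_)
  refine (norm_sum_le _ _).trans ?_
  simp [norm_exp_I_mul]

theorem cov_expSum (N : ℕ) (k₁ k₂ : ℝ) :
    cov N (expSum N k₁) (expSum N k₂) = traceElement N (k₁ + k₂) - traceProduct N k₁ k₂ := by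
  have h1 : cov N (expSum N k₁) (expSum N k₂) =
      average N (fun x => expSum N k₁ x * expSum N k₂ x) -
        average N (expSum N k₁) * average N (expSum N k₂) := by
    unfold cov
    set α := average N (expSum N k₁) with hα
    set β := average N (expSum N k₂) with hβ
    have h2 : ∀ x, (expSum N k₁ x - α) * (expSum N k₂ x - β) =
        expSum N k₁ x * expSum N k₂ x - β * expSum N k₁ x - α * expSum N k₂ x + α * β :=
      fun x => by ring
    simp only [h2]
    unfold average at hα hβ ⊢
    rw [integral_add, integral_sub, integral_sub, integral_const_mul, integral_const_mul, ← hα,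
      ← hβ, integral_const]
    · simp
      ring
    · exact integrable_expSum_mul N k₁ k₂
    · exact (integrable_expSum N k₁).const_mul _
    · exact (integrable_expSum_mul N k₁ k₂).sub ((integrable_expSum N k₁).const_mul _)
    · exact (integrable_expSum N k₂).const_mul _
    · exact ((integrable_expSum_mul N k₁ k₂).sub ((integrable_expSum N k₁).const_mul _)).sub
        ((integrable_expSum N k₂).const_mul _)
    · exact integrable_const _
  rw [h1, average_expSum_mul, average_expSum, average_expSum]
  ring

theorem conj_expSum (N : ℕ) (k : ℝ) (x : Fin N → ℝ) :
    (starRingEnd ℂ) (expSum N k x) = expSum N (-k) x := by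
  unfold expSum
  rw [map_sum]
  refine Finset.sum_congr rfl fun j _ => ?_
  rw [← Complex.exp_conj]
  simp

/-- Conjugating an exponential sum flips the sign of `k`, so this is the covariance on the line `k₁
+ k₂ = 0`, excluded from the third claim. -/
theorem structureFunction_eq_cov (N : ℕ) (k : ℝ) :
    (structureFunction N k : ℂ) = cov N (expSum N k) (expSum N (-k)) := by
  have h1 : (starRingEnd ℂ) (average N (expSum N k)) = average N (expSum N (-k)) := by
    unfold average
    rw [← integral_conj]
    simp only [conj_expSum]
  have h2 : ∀ z : ℂ, ((‖z‖ ^ 2 : ℝ) : ℂ) = z * (starRingEnd ℂ) z := fun z => by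
    rw [Complex.mul_conj, Complex.normSq_eq_norm_sq]
  have h3 : (((∫ x, ‖expSum N k x‖ ^ 2 ∂(eigenvalueLaw N)) : ℝ) : ℂ) =
      average N (fun x => expSum N k x * expSum N (-k) x) := by
    rw [← integral_complex_ofReal]
    simp only [h2, conj_expSum]
    rfl
  unfold structureFunction
  rw [Complex.ofReal_sub, h3, h2, h1, average_expSum_mul, cov_expSum, average_expSum,
    average_expSum]
  ring

end GUE

/-! ### Bessel functions -/

theorem besselJ_zero_neg (x : ℝ) : besselJ 0 (-x) = besselJ 0 x := by
  unfold besselJ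
  congr 1 with m
  rw [neg_div, add_zero, add_zero, pow_mul, pow_mul, neg_sq]

theorem besselJ_one_neg (x : ℝ) : besselJ 1 (-x) = -besselJ 1 x := by
  unfold besselJ
  rw [← tsum_neg]
  congr 1 with m
  rw [neg_div, pow_succ, pow_succ, pow_mul, pow_mul, neg_sq]
  ring

theorem besselJ_zero_zero : besselJ 0 0 = 1 := by
  unfold besselJ
  rw [tsum_eq_single 0 (fun m hm => by simp [hm])]
  simp

theorem besselJ_one_zero : besselJ 1 0 = 0 := by
  unfold besselJ
  simp

/-- Termwise differentiation of a power series with factorially decaying coefficients. -/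
theorem hasDerivAt_tsum_of_factorial_bound (c : ℕ → ℝ) (e : ℕ → ℕ) (he : ∀ m, e m ≤ 2 * m + 2)
    (hc : ∀ m, |c m| ≤ 1 / (m.factorial : ℝ)) (x : ℝ) :
    HasDerivAt (fun y : ℝ => ∑' m, c m * y ^ e m)
      (∑' m, c m * (e m * x ^ (e m - 1))) x := by
  set R : ℝ := |x| + 1 with hR
  have hR1 : 1 ≤ R := by rw [hR]; linarith [abs_nonneg x]
  have hsum : Summable fun m : ℕ => R ^ 2 * ((4 * R ^ 2) ^ m / (m.factorial : ℝ)) * 2 :=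
    ((Real.summable_pow_div_factorial (4 * R ^ 2)).mul_left _).mul_right _
  have hpos : ∀ m : ℕ, (0 : ℝ) < m.factorial := fun m => by exact_mod_cast m.factorial_pos
  -- The factor `e m` produced by differentiation is absorbed into a geometric one, so an
  -- exponential series in `4 R²` dominates on `(-R, R)`.
  have hbd : ∀ m : ℕ, 2 * (m : ℝ) + 2 ≤ 2 * 4 ^ m := by
    intro m
    have h1 : m + 1 ≤ 4 ^ m := by
      have h2 : m < 2 ^ m := Nat.lt_two_pow_self
      exact Nat.succ_le_of_lt (h2.trans_le (Nat.pow_le_pow_left (by norm_num) m))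
    have h3 : ((m + 1 : ℕ) : ℝ) ≤ ((4 ^ m : ℕ) : ℝ) := by exact_mod_cast h1
    push_cast at h3
    linarith
  refine hasDerivAt_tsum_of_isPreconnected (𝕜 := ℝ) hsum (t := Set.Ioo (-R) R)
    (g := fun m y => c m * y ^ e m) (g' := fun m y => c m * (e m * y ^ (e m - 1)))
    isOpen_Ioo isPreconnected_Ioo (fun m y _ => ?_) (fun m y hy => ?_) (y₀ := 0) ?_ ?_ ?_
  · exact (hasDerivAt_pow (e m) y).const_mul (c m)
  · have hy' : |y| ≤ R := (abs_lt.2 hy).le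
    rw [norm_mul, norm_mul, norm_pow, Real.norm_eq_abs, Real.norm_eq_abs, Real.norm_eq_abs,
      Nat.abs_cast]
    have h1 : |y| ^ (e m - 1) ≤ R ^ (2 * m + 2) :=
      (pow_le_pow_left₀ (abs_nonneg y) hy' _).trans
        (pow_le_pow_right₀ hR1 (by have := he m; omega))
    have h2 : (e m : ℝ) ≤ 2 * 4 ^ m := by
      have : (e m : ℝ) ≤ ((2 * m + 2 : ℕ) : ℝ) := by exact_mod_cast he m
      push_cast at this
      exact this.trans (hbd m)
    calc |c m| * (e m * |y| ^ (e m - 1))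
        ≤ 1 / (m.factorial : ℝ) * (2 * 4 ^ m * R ^ (2 * m + 2)) := by
          gcongr
          exact hc m
      _ = _ := by rw [mul_pow, pow_add, pow_mul]; ring
  · constructor <;> linarith
  · refine Summable.of_norm_bounded hsum fun m => ?_
    rw [norm_mul, norm_pow, norm_zero, Real.norm_eq_abs]
    have h1 : (0 : ℝ) ^ e m ≤ 1 := pow_le_one₀ le_rfl zero_le_one
    have h4 : (1 : ℝ) ≤ R ^ 2 := one_le_pow₀ hR1
    have h5 : (1 : ℝ) ≤ (4 * R ^ 2) ^ m := one_le_pow₀ (by linarith)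
    have hp := hpos m
    calc |c m| * 0 ^ e m ≤ 1 / (m.factorial : ℝ) * 1 := by
          gcongr
          exact hc m
      _ = 1 * (1 / (m.factorial : ℝ)) * 1 := by ring
      _ ≤ R ^ 2 * ((4 * R ^ 2) ^ m / (m.factorial : ℝ)) * 2 := by
          gcongr
          norm_num
  · rw [hR]
    constructor
    · linarith [neg_abs_le x]
    · linarith [le_abs_self x]

theorem abs_besselCoeff_le (m n : ℕ) (k : ℕ) :
    |(-1 : ℝ) ^ m / ((m.factorial : ℝ) * ((m + n).factorial : ℝ)) * (1 / 2) ^ k| ≤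
      1 / (m.factorial : ℝ) := by
  have h1 : (1 : ℝ) ≤ ((m + n).factorial : ℝ) := by exact_mod_cast Nat.factorial_pos _
  have h2 : (0 : ℝ) < (m.factorial : ℝ) := by exact_mod_cast Nat.factorial_pos _
  rw [abs_mul, abs_div, abs_pow, abs_neg, abs_one, one_pow, abs_of_pos (by positivity : (0 : ℝ) <
    (m.factorial : ℝ) * ((m + n).factorial : ℝ)), abs_of_pos (by positivity : (0 : ℝ) < (1 / 2) ^ k)]
  calc 1 / ((m.factorial : ℝ) * ((m + n).factorial : ℝ)) * (1 / 2) ^ k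
      ≤ 1 / ((m.factorial : ℝ) * ((m + n).factorial : ℝ)) * 1 := by
        gcongr
        exact pow_le_one₀ (by norm_num) (by norm_num)
    _ ≤ 1 / (m.factorial : ℝ) := by
        rw [mul_one]
        exact one_div_le_one_div_of_le h2 (le_mul_of_one_le_right h2.le h1)

theorem hasDerivAt_besselJ_zero (x : ℝ) : HasDerivAt (besselJ 0) (-besselJ 1 x) x := by
  have h := hasDerivAt_tsum_of_factorial_bound
    (fun m => (-1 : ℝ) ^ m / ((m.factorial : ℝ) * ((m + 0).factorial : ℝ)) * (1 / 2) ^ (2 * m))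
    (fun m => 2 * m) (fun m => by omega) (fun m => abs_besselCoeff_le m 0 _) x
  have hs : Summable fun m : ℕ => (-1 : ℝ) ^ m / ((m.factorial : ℝ) * ((m + 0).factorial : ℝ)) *
      (1 / 2) ^ (2 * m) * ((2 * m : ℕ) * x ^ (2 * m - 1)) := by
    rw [← summable_nat_add_iff 1]
    refine (besselJ_summable 1 x).neg.congr fun m => ?_
    rw [show 2 * (m + 1) - 1 = 2 * m + 1 by omega, show 2 * (m + 1) = 2 * m + 1 + 1 by ring,
      add_zero, Nat.factorial_succ, div_pow, div_pow, one_pow]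
    have h2 : (m.factorial : ℝ) ≠ 0 := by exact_mod_cast m.factorial_ne_zero
    push_cast
    field_simp
    ring
  convert h using 1
  · funext y
    unfold besselJ
    congr 1 with m
    rw [add_zero, div_pow, div_pow]
    ring
  -- The constant term differentiates to zero; shifting the index by one gives the series of `-J₁`.
  · rw [hs.tsum_eq_zero_add]
    simp only [mul_zero, Nat.cast_zero, zero_mul, zero_add]
    unfold besselJ
    rw [← tsum_neg]
    congr 1 with m
    rw [show 2 * (m + 1) - 1 = 2 * m + 1 by omega, show 2 * (m + 1) = 2 * m + 1 + 1 by ring,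
      add_zero, Nat.factorial_succ, div_pow, div_pow, one_pow]
    have h2 : (m.factorial : ℝ) ≠ 0 := by exact_mod_cast m.factorial_ne_zero
    push_cast
    field_simp
    ring

theorem hasDerivAt_mul_besselJ_one (x : ℝ) :
    HasDerivAt (fun y => y * besselJ 1 y) (x * besselJ 0 x) x := by
  have h := hasDerivAt_tsum_of_factorial_bound
    (fun m => (-1 : ℝ) ^ m / ((m.factorial : ℝ) * ((m + 1).factorial : ℝ)) * (1 / 2) ^ (2 * m + 1))
    (fun m => 2 * m + 2) (fun m => le_rfl) (fun m => abs_besselCoeff_le m 1 _) x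
  convert h using 1
  · funext y
    unfold besselJ
    rw [← tsum_mul_left]
    congr 1 with m
    rw [div_pow, div_pow]
    ring
  · unfold besselJ
    rw [← tsum_mul_left]
    congr 1 with m
    rw [show 2 * m + 2 - 1 = 2 * m + 1 by omega, add_zero, Nat.factorial_succ, div_pow, div_pow]
    have h2 : (m.factorial : ℝ) ≠ 0 := by exact_mod_cast m.factorial_ne_zero
    push_cast
    field_simp
    ring

theorem continuous_besselJ_one : Continuous (besselJ 1) := by
  rw [continuous_iff_continuousAt]
  intro x
  have h := hasDerivAt_tsum_of_factorial_bound
    (fun m => (-1 : ℝ) ^ m / ((m.factorial : ℝ) * ((m + 1).factorial : ℝ)) * (1 / 2) ^ (2 * m + 1))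
    (fun m => 2 * m + 1) (fun m => by omega) (fun m => abs_besselCoeff_le m 1 _) x
  have heq : besselJ 1 = fun y => ∑' m : ℕ, (-1 : ℝ) ^ m / ((m.factorial : ℝ) *
      ((m + 1).factorial : ℝ)) * (1 / 2) ^ (2 * m + 1) * y ^ (2 * m + 1) := by
    funext y
    unfold besselJ
    congr 1 with m
    rw [div_pow, div_pow]
    ring
  rw [heq]
  exact h.continuousAt

/-- A perturbation of the Bessel system `p' = -r`, `(t r)' = t p` stays close to `J₀, J₁`. -/
theorem norm_sub_besselJ_le_of_nonneg {p r : ℝ → ℂ} {ε : ℝ} (hε : 0 ≤ ε)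
    (hp : ∀ t : ℝ, HasDerivAt p (-((1 - ε * t ^ 2) * r t)) t)
    (hr : ∀ t : ℝ, HasDerivAt (fun t : ℝ => t * r t) (t * p t) t)
    (hrc : Continuous r) (hp0 : p 0 = 1) (hr0 : r 0 = 0) (hr1 : ∀ t, ‖r t‖ ≤ 1)
    {T : ℝ} (hT : 0 ≤ T) :
    ‖p T - besselJ 0 T‖ ≤ 2 * ε * T ^ 3 ∧ ‖r T - besselJ 1 T‖ ≤ 2 * ε * T ^ 3 := by
  set d : ℝ → ℂ := fun t => p t - besselJ 0 t with hd
  set e : ℝ → ℂ := fun t => r t - besselJ 1 t with he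
  have hd' : ∀ t : ℝ, HasDerivAt d (-(e t) + ε * t ^ 2 * r t) t := by
    intro t
    refine ((hp t).sub (hasDerivAt_besselJ_zero t).ofReal_comp).congr_deriv ?_
    simp only [he]
    push_cast
    ring
  -- The system is singular at `0`, so `e` is differentiated only for `t > 0`; continuity covers the
  -- endpoint.
  have he' : ∀ t : ℝ, 0 < t → HasDerivAt e (d t - e t / t) t := by
    intro t ht
    have ht0 : (t : ℂ) ≠ 0 := by exact_mod_cast ht.ne'
    have h1 : HasDerivAt (fun t : ℝ => (t : ℂ) * e t) (t * d t) t := by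
      refine (((hr t).sub (hasDerivAt_mul_besselJ_one t).ofReal_comp).congr_deriv
        ?_).congr_of_eventuallyEq (Eventually.of_forall fun y => ?_)
      · simp only [hd]
        push_cast
        ring
      · simp only [he, Pi.sub_apply]
        push_cast
        ring
    have h2 : HasDerivAt (fun t : ℝ => (t : ℂ)) 1 t := Complex.ofRealCLM.hasDerivAt
    have h3 := h1.div h2 ht0
    refine (h3.congr_deriv ?_).congr_of_eventuallyEq ?_
    · field_simp
    · filter_upwards [eventually_ne_nhds ht.ne'] with y hy
      have hy0 : (y : ℂ) ≠ 0 := by exact_mod_cast hy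
      rw [Pi.div_apply]
      field_simp
  have hdc : Continuous d := continuous_iff_continuousAt.2 fun t => (hd' t).continuousAt
  have hec : Continuous e := hrc.sub (Complex.continuous_ofReal.comp continuous_besselJ_one)
  -- Bounding the forcing by the maximum `M` of `‖d‖` makes the energy inequality at the maximizer
  -- read `M² ≤ 2 ε T³ M`, which closes without Grönwall.
  obtain ⟨s, hs, hmax⟩ := isCompact_Icc.exists_isMaxOn (Set.nonempty_Icc.2 hT)
    hdc.norm.continuousOn
  set M : ℝ := ‖d s‖ with hM
  have hM0 : 0 ≤ M := norm_nonneg _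
  set E : ℝ → ℝ := fun t => ‖d t‖ ^ 2 + ‖e t‖ ^ 2 - 2 * ε * T ^ 2 * M * t with hE
  -- In the derivative of `‖d‖² + ‖e‖²` the cross terms cancel and `-e / t` only damps; the
  -- remaining forcing is at most `2 ε T² M`, the slope subtracted in `E`.
  have hanti : AntitoneOn E (Set.Icc 0 T) := by
    refine antitoneOn_of_hasDerivWithinAt_nonpos (convex_Icc 0 T)
      (f' := fun t => 2 * inner ℝ (d t) (-(e t) + ε * t ^ 2 * r t) +
        2 * inner ℝ (e t) (d t - e t / t) - 2 * ε * T ^ 2 * M)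
      (by rw [hE]; fun_prop) (fun t ht => ?_) (fun t ht => ?_)
    · rw [interior_Icc] at ht
      have h := (((hd' t).norm_sq).add ((he' t ht.1).norm_sq)).sub
        ((hasDerivAt_id t).const_mul (2 * ε * T ^ 2 * M))
      exact (h.congr_deriv (by rw [mul_one])).hasDerivWithinAt
    · rw [interior_Icc] at ht
      have h1 : inner ℝ (e t) (e t / (t : ℂ)) = ‖e t‖ ^ 2 / t := by
        rw [div_eq_inv_mul, ← Complex.ofReal_inv, ← Complex.real_smul, inner_smul_right,
          real_inner_self_eq_norm_sq]
        ring
      have h2 : inner ℝ (d t) (ε * t ^ 2 * r t) ≤ ε * T ^ 2 * M := by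
        refine (real_inner_le_norm _ _).trans ?_
        rw [norm_mul, show (ε : ℂ) * (t : ℂ) ^ 2 = ((ε * t ^ 2 : ℝ) : ℂ) by push_cast; ring,
          Complex.norm_real, Real.norm_of_nonneg (by positivity)]
        have h3 : ‖d t‖ ≤ M := hmax ⟨ht.1.le, ht.2.le⟩
        have h4 : t ^ 2 ≤ T ^ 2 := pow_le_pow_left₀ ht.1.le ht.2.le 2
        calc ‖d t‖ * (ε * t ^ 2 * ‖r t‖) ≤ M * (ε * T ^ 2 * 1) := by
              gcongr
              exact hr1 t
          _ = ε * T ^ 2 * M := by ring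
      have h5 : 0 ≤ ‖e t‖ ^ 2 / t := div_nonneg (sq_nonneg _) ht.1.le
      have h6 : inner ℝ (d t) (-(e t) + ε * t ^ 2 * r t) =
          -inner ℝ (d t) (e t) + inner ℝ (d t) (ε * t ^ 2 * r t) := by
        rw [inner_add_right, inner_neg_right]
      have h7 : inner ℝ (e t) (d t - e t / t) = inner ℝ (d t) (e t) - ‖e t‖ ^ 2 / t := by
        rw [inner_sub_right, h1, real_inner_comm]
      rw [h6, h7]
      linarith
  have hE0 : E 0 = 0 := by
    simp [hE, hd, he, hp0, hr0, besselJ_zero_zero, besselJ_one_zero]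
  have hEs : ∀ t ∈ Set.Icc 0 T, ‖d t‖ ^ 2 + ‖e t‖ ^ 2 ≤ 2 * ε * T ^ 3 * M := by
    intro t ht
    have h := hanti (Set.left_mem_Icc.2 hT) ht ht.1
    rw [hE0] at h
    have h2 : 2 * ε * T ^ 2 * M * t ≤ 2 * ε * T ^ 2 * M * T := by
      have := ht.2
      gcongr
    have h3 : E t = ‖d t‖ ^ 2 + ‖e t‖ ^ 2 - 2 * ε * T ^ 2 * M * t := rfl
    nlinarith
  have hK : 0 ≤ 2 * ε * T ^ 3 := by positivity
  have hMle : M ≤ 2 * ε * T ^ 3 := by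
    have h := hEs s hs
    have h2 : M ^ 2 ≤ 2 * ε * T ^ 3 * M := by
      rw [hM] at h ⊢
      nlinarith [sq_nonneg ‖e s‖]
    by_contra hlt
    push Not at hlt
    nlinarith
  have hfin := hEs T (Set.right_mem_Icc.2 hT)
  have hsq : ‖d T‖ ^ 2 + ‖e T‖ ^ 2 ≤ (2 * ε * T ^ 3) ^ 2 := by nlinarith
  constructor
  · exact abs_le_of_sq_le_sq (a := ‖d T‖) (by nlinarith [sq_nonneg ‖e T‖]) hK |>.trans' (le_abs_self _)
  · exact abs_le_of_sq_le_sq (a := ‖e T‖) (by nlinarith [sq_nonneg ‖d T‖]) hK |>.trans' (le_abs_self _)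

/-- A perturbation of the Bessel system `p' = -r`, `(t r)' = t p` stays close to `J₀, J₁`. -/
theorem norm_sub_besselJ_le {p r : ℝ → ℂ} {ε : ℝ} (hε : 0 ≤ ε)
    (hp : ∀ t : ℝ, HasDerivAt p (-((1 - ε * t ^ 2) * r t)) t)
    (hr : ∀ t : ℝ, HasDerivAt (fun t : ℝ => t * r t) (t * p t) t)
    (hrc : Continuous r) (hp0 : p 0 = 1) (hr0 : r 0 = 0) (hr1 : ∀ t, ‖r t‖ ≤ 1) (T : ℝ) :
    ‖p T - besselJ 0 T‖ ≤ 2 * ε * |T| ^ 3 ∧ ‖r T - besselJ 1 T‖ ≤ 2 * ε * |T| ^ 3 := by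
  rcases le_total 0 T with hT | hT
  · rw [abs_of_nonneg hT]
    exact norm_sub_besselJ_le_of_nonneg hε hp hr hrc hp0 hr0 hr1 hT
  -- The perturbed system keeps the parity symmetry of the Bessel system, under which `p` is
  -- reflected evenly and `r` oddly.
  · have h := norm_sub_besselJ_le_of_nonneg (p := fun t => p (-t)) (r := fun t => -r (-t)) hε
      (fun t => ?_) (fun t => ?_) (by fun_prop) (by simpa using hp0) (by simpa using hr0)
      (fun t => by simpa using hr1 (-t)) (neg_nonneg.2 hT)
    · rw [abs_of_nonpos hT]
      simp only [neg_neg, besselJ_zero_neg, besselJ_one_neg, Complex.ofReal_neg] at h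
      rw [← neg_add', norm_neg, ← sub_eq_add_neg] at h
      exact h
    · refine ((hp (-t)).scomp t (hasDerivAt_neg t)).congr_deriv ?_
      simp
    · refine (((hr (-t)).scomp t (hasDerivAt_neg t)).congr_deriv ?_).congr_of_eventuallyEq
        (Eventually.of_forall fun y => ?_)
      · simp
      · simp

namespace GUE

/-! ### Exact relations at finite `N` -/

/-- The diagonal commutator identity is a difference of consecutive values of `√2 √j m_{j,j-1}`,
which vanishes at `j = 0`. -/
theorem mul_traceElement (N : ℕ) (t : ℝ) :
    Complex.I * t * traceElement N t = √2 * (√(N : ℝ) * matrixElement N (N - 1) t) := by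
  rw [traceElement, Finset.mul_sum]
  have h := Finset.sum_range_sub
    (fun j : ℕ => (√2 : ℂ) * (√(j : ℝ) * matrixElement j (j - 1) t)) N
  rw [Nat.cast_zero, Real.sqrt_zero, Complex.ofReal_zero, zero_mul, mul_zero, sub_zero] at h
  rw [← h]
  refine Finset.sum_congr rfl fun j _ => ?_
  rw [matrixElement_commutator, Nat.add_sub_cancel]
  push_cast
  ring

/-- The off-diagonal element joining the last two Hermite functions in the product of the
truncations of `exp (i k₁ x)` and `exp (i k₂ x)`. -/
noncomputable def edgeProduct (N : ℕ) (k₁ k₂ : ℝ) : ℂ :=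
  ∑ j ∈ Finset.range N, matrixElement N j k₁ * matrixElement j (N - 1) k₂

/-- Apply the commutator identity to each of the two factors and regroup: one half telescopes in the
row index, the other in the column index. -/
theorem mul_traceProduct (N : ℕ) (k₁ k₂ : ℝ) :
    Complex.I * (k₁ + k₂) * traceProduct N k₁ k₂ =
      √2 * (√(N : ℝ) * (edgeProduct N k₁ k₂ + edgeProduct N k₂ k₁)) := by
  have hF : ∀ j : ℕ, ∑ i ∈ Finset.range N,
      ((√((i : ℝ) + 1) : ℂ) * matrixElement (i + 1) j k₁ * matrixElement j i k₂ -
        √(i : ℝ) * matrixElement i j k₁ * matrixElement j (i - 1) k₂) =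
      √(N : ℝ) * matrixElement N j k₁ * matrixElement j (N - 1) k₂ := by
    intro j
    have h := Finset.sum_range_sub
      (fun i : ℕ => (√(i : ℝ) : ℂ) * matrixElement i j k₁ * matrixElement j (i - 1) k₂) N
    rw [Nat.cast_zero, Real.sqrt_zero, Complex.ofReal_zero, zero_mul, zero_mul, sub_zero] at h
    rw [← h]
    refine Finset.sum_congr rfl fun i _ => ?_
    rw [Nat.add_sub_cancel]
    push_cast
    ring
  have hG : ∀ i : ℕ, ∑ j ∈ Finset.range N,
      ((√((j : ℝ) + 1) : ℂ) * matrixElement i j k₁ * matrixElement (j + 1) i k₂ -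
        √(j : ℝ) * matrixElement i (j - 1) k₁ * matrixElement j i k₂) =
      √(N : ℝ) * matrixElement i (N - 1) k₁ * matrixElement N i k₂ := by
    intro i
    have h := Finset.sum_range_sub
      (fun j : ℕ => (√(j : ℝ) : ℂ) * matrixElement i (j - 1) k₁ * matrixElement j i k₂) N
    rw [Nat.cast_zero, Real.sqrt_zero, Complex.ofReal_zero, zero_mul, zero_mul, sub_zero] at h
    rw [← h]
    refine Finset.sum_congr rfl fun j _ => ?_
    rw [Nat.add_sub_cancel]
    push_cast
    ring
  have hterm : ∀ i j : ℕ, Complex.I * (k₁ + k₂) * (matrixElement i j k₁ * matrixElement i j k₂) =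
      √2 * ((√((i : ℝ) + 1) : ℂ) * matrixElement (i + 1) j k₁ * matrixElement j i k₂ -
        √(i : ℝ) * matrixElement i j k₁ * matrixElement j (i - 1) k₂) +
      √2 * ((√((j : ℝ) + 1) : ℂ) * matrixElement i j k₁ * matrixElement (j + 1) i k₂ -
        √(j : ℝ) * matrixElement i (j - 1) k₁ * matrixElement j i k₂) := by
    intro i j
    have h1 := matrixElement_commutator i j k₁
    have h2 := matrixElement_commutator j i k₂
    rw [matrixElement_comm i j k₂]
    linear_combination matrixElement j i k₂ * h1 + matrixElement i j k₁ * h2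
  rw [traceProduct, Finset.mul_sum]
  simp only [Finset.mul_sum, hterm, Finset.sum_add_distrib]
  rw [Finset.sum_comm]
  simp only [← Finset.mul_sum, hF, hG]
  rw [edgeProduct, edgeProduct, mul_add, mul_add, Finset.mul_sum, Finset.mul_sum, Finset.mul_sum,
    Finset.mul_sum, Finset.mul_sum, Finset.mul_sum]
  congr 1
  · exact Finset.sum_congr rfl fun j _ => by ring
  · exact Finset.sum_congr rfl fun j _ => by rw [matrixElement_comm j (N - 1)]; ring

/-! ### Derivatives along the lines `k₁ + k₂ = s` -/

theorem hasDerivAt_comp_sub {f : ℝ → ℂ} {f' : ℂ} {s u : ℝ} (h : HasDerivAt f f' (s - u)) :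
    HasDerivAt (fun u => f (s - u)) (-f') u := by
  refine (h.scomp u ((hasDerivAt_id u).const_sub s)).congr_deriv ?_
  simp

/-- A Christoffel–Darboux argument: multiplication by `x` is symmetric and tridiagonal, so moving it
across the truncated sum leaves only a boundary term. -/
theorem edgeProduct_telescope (N : ℕ) (k₁ k₂ : ℝ) :
    ∑ j ∈ Finset.range N,
      ((√((j : ℝ) + 1) * matrixElement (j + 1) N k₁ + √(j : ℝ) * matrixElement (j - 1) N k₁) *
          matrixElement j (N - 1) k₂ -
        matrixElement N j k₁ * (√((j : ℝ) + 1) * matrixElement (j + 1) (N - 1) k₂ +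
          √(j : ℝ) * matrixElement (j - 1) (N - 1) k₂)) =
      √(N : ℝ) * (matrixElement N N k₁ * matrixElement (N - 1) (N - 1) k₂ -
        matrixElement N (N - 1) k₁ * matrixElement N (N - 1) k₂) := by
  have h := Finset.sum_range_sub (fun j : ℕ => (√(j : ℝ) : ℂ) *
    (matrixElement j N k₁ * matrixElement (j - 1) (N - 1) k₂ -
      matrixElement (j - 1) N k₁ * matrixElement j (N - 1) k₂)) N
  rw [Nat.cast_zero, Real.sqrt_zero, Complex.ofReal_zero, zero_mul, sub_zero] at h
  rw [matrixElement_comm N (N - 1) k₁, ← h]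
  refine Finset.sum_congr rfl fun j _ => ?_
  rw [Nat.add_sub_cancel, matrixElement_comm N j]
  push_cast
  ring

theorem hasDerivAt_edgeProduct_left (N : ℕ) (s u : ℝ) :
    HasDerivAt (fun u => edgeProduct N u (s - u)) (Complex.I / √2 *
      (√(N : ℝ) * (matrixElement N N u * matrixElement (N - 1) (N - 1) (s - u) -
        matrixElement N (N - 1) u * matrixElement N (N - 1) (s - u)))) u := by
  have h : HasDerivAt (fun u => edgeProduct N u (s - u)) _ u :=
    HasDerivAt.fun_sum fun j _ => HasDerivAt.mul
      ((hasDerivAt_matrixElement j N u).congr_of_eventuallyEq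
        (Eventually.of_forall fun y => matrixElement_comm N j y))
      (hasDerivAt_comp_sub (hasDerivAt_matrixElement j (N - 1) (s - u)))
  refine h.congr_deriv ?_
  rw [← edgeProduct_telescope, Finset.mul_sum]
  exact Finset.sum_congr rfl fun j _ => by ring

theorem hasDerivAt_edgeProduct_right (N : ℕ) (s u : ℝ) :
    HasDerivAt (fun u => edgeProduct N (s - u) u) (-(Complex.I / √2 *
      (√(N : ℝ) * (matrixElement N N (s - u) * matrixElement (N - 1) (N - 1) u -
        matrixElement N (N - 1) (s - u) * matrixElement N (N - 1) u)))) u := by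
  have h := hasDerivAt_edgeProduct_left N s (s - u)
  have h2 := hasDerivAt_comp_sub h
  simpa only [sub_sub_cancel] using h2

/-- The covariance of two exponential sums, expressed through matrix elements. -/
noncomputable def covKernel (N : ℕ) (k₁ k₂ : ℝ) : ℂ :=
  traceElement N (k₁ + k₂) - traceProduct N k₁ k₂

theorem covKernel_zero_right (N : ℕ) (k : ℝ) : covKernel N k 0 = 0 := by
  rw [covKernel, add_zero, traceElement, traceProduct, sub_eq_zero]
  refine Finset.sum_congr rfl fun i hi => ?_
  rw [Finset.sum_eq_single i]
  · rw [matrixElement_at_zero, if_pos rfl, mul_one]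
  · intro j _ hj
    rw [matrixElement_at_zero, if_neg hj.symm, mul_zero]
  · exact fun h => absurd hi h

theorem continuous_covKernel_left (N : ℕ) (k₂ : ℝ) : Continuous fun k₁ => covKernel N k₁ k₂ := by
  unfold covKernel traceElement traceProduct
  refine Continuous.sub ?_ ?_
  · exact continuous_finsetSum _ fun j _ =>
      (continuous_matrixElement j j).comp (continuous_id.add continuous_const)
  · exact continuous_finsetSum _ fun i _ => continuous_finsetSum _ fun j _ =>
      (continuous_matrixElement i j).mul continuous_const

/-- `traceElement N s` is constant along the line, and the products of off-diagonal elements cancel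
between the two edge products. -/
theorem hasDerivAt_mul_covKernel (N : ℕ) (s u : ℝ) :
    HasDerivAt (fun u => (s : ℂ) * covKernel N (s - u) u)
      (N * (matrixElement N N (s - u) * matrixElement (N - 1) (N - 1) u -
        matrixElement N N u * matrixElement (N - 1) (N - 1) (s - u))) u := by
  have hT : ∀ u : ℝ, (s : ℂ) * covKernel N (s - u) u = s * traceElement N s +
      Complex.I * (√2 * (√(N : ℝ) * (edgeProduct N (s - u) u + edgeProduct N u (s - u)))) := by
    intro u
    have h := mul_traceProduct N (s - u) u
    rw [covKernel, sub_add_cancel]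
    push_cast at h
    linear_combination (Complex.I) * h - s * traceProduct N (s - u) u * Complex.I_sq
  have h0 : (√2 : ℂ) ≠ 0 := by
    rw [Complex.ofReal_ne_zero]; positivity
  have hN : (√(N : ℝ) : ℂ) * √(N : ℝ) = N := by
    rw [← Complex.ofReal_mul, Real.mul_self_sqrt (Nat.cast_nonneg N), Complex.ofReal_natCast]
  have h := (((((hasDerivAt_edgeProduct_right N s u).add
    (hasDerivAt_edgeProduct_left N s u)).const_mul (√(N : ℝ) : ℂ)).const_mul
      (√2 : ℂ)).const_mul Complex.I).const_add ((s : ℂ) * traceElement N s)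
  refine (h.congr_deriv ?_).congr_of_eventuallyEq (Eventually.of_forall hT)
  rw [← hN]
  field_simp
  rw [Complex.I_sq]
  ring

/-! ### Scaled quantities -/

/-- The mean of the two diagonal elements at the edge of the truncation, on the scale of the
spectrum. -/
noncomputable def scaledDiag (N : ℕ) (τ : ℝ) : ℂ :=
  (matrixElement N N (τ / √(2 * (N : ℝ))) +
    matrixElement (N - 1) (N - 1) (τ / √(2 * (N : ℝ)))) / 2

/-- The off-diagonal element at the edge of the truncation, on the scale of the spectrum. -/
noncomputable def scaledOffDiag (N : ℕ) (τ : ℝ) : ℂ :=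
  -(Complex.I * matrixElement N (N - 1) (τ / √(2 * (N : ℝ))))

theorem norm_scaledDiag_le (N : ℕ) (τ : ℝ) : ‖scaledDiag N τ‖ ≤ 1 := by
  rw [scaledDiag, norm_div, Complex.norm_ofNat, div_le_one (by norm_num)]
  refine (norm_add_le _ _).trans ?_
  linarith [norm_matrixElement_le N N (τ / √(2 * (N : ℝ))),
    norm_matrixElement_le (N - 1) (N - 1) (τ / √(2 * (N : ℝ)))]

theorem norm_scaledOffDiag_le (N : ℕ) (τ : ℝ) : ‖scaledOffDiag N τ‖ ≤ 1 := by
  rw [scaledOffDiag, norm_neg, norm_mul, Complex.norm_I, one_mul]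
  exact norm_matrixElement_le _ _ _

theorem continuous_scaledOffDiag (N : ℕ) : Continuous (scaledOffDiag N) :=
  (continuous_const.mul ((continuous_matrixElement N (N - 1)).comp
    (continuous_id.div_const _))).neg

theorem scaledDiag_zero (N : ℕ) : scaledDiag N 0 = 1 := by
  rw [scaledDiag, zero_div, matrixElement_at_zero, matrixElement_at_zero, if_pos rfl, if_pos rfl]
  norm_num

theorem scaledOffDiag_zero {N : ℕ} (hN : N ≠ 0) : scaledOffDiag N 0 = 0 := by
  rw [scaledOffDiag, zero_div, matrixElement_at_zero, if_neg (by omega)]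
  simp

theorem sqrt_two_mul_natCast (N : ℕ) : ((√(2 * (N : ℝ)) : ℝ) : ℂ) = √2 * √(N : ℝ) := by
  rw [Real.sqrt_mul (by norm_num), Complex.ofReal_mul]

theorem sq_sqrt_two_mul_natCast (N : ℕ) : ((√(2 * (N : ℝ)) : ℝ) : ℂ) ^ 2 = 2 * N := by
  rw [← Complex.ofReal_pow, Real.sq_sqrt (by positivity)]
  push_cast
  rfl

theorem sqrt_two_mul_natCast_ne_zero {N : ℕ} (hN : N ≠ 0) :
    ((√(2 * (N : ℝ)) : ℝ) : ℂ) ≠ 0 := by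
  rw [Complex.ofReal_ne_zero]
  have : (0 : ℝ) < N := by exact_mod_cast Nat.pos_of_ne_zero hN
  positivity

/-- The commutator identity at `(N - 1, N)`. It shows that the two diagonal edge elements differ by
`τ r / (2N)`. -/
theorem mul_scaledOffDiag {N : ℕ} (hN : N ≠ 0) (τ : ℝ) :
    τ * scaledOffDiag N τ = 2 * N * (matrixElement (N - 1) (N - 1) (τ / √(2 * (N : ℝ))) -
      matrixElement N N (τ / √(2 * (N : ℝ)))) := by
  obtain ⟨n, rfl⟩ := Nat.exists_eq_succ_of_ne_zero hN
  have h := matrixElement_commutator n (n + 1) (τ / √(2 * ((n + 1 : ℕ) : ℝ)))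
  have hσ := sqrt_two_mul_natCast_ne_zero hN
  have h1 := sqrt_two_mul_natCast (n + 1)
  have h2 := sq_sqrt_two_mul_natCast (n + 1)
  rw [scaledOffDiag]
  simp only [Nat.succ_eq_add_one, Nat.add_sub_cancel] at *
  rw [matrixElement_comm (n + 1) n]
  generalize matrixElement n (n + 1) (τ / √(2 * ((n + 1 : ℕ) : ℝ))) = c at *
  generalize matrixElement n n (τ / √(2 * ((n + 1 : ℕ) : ℝ))) = B at *
  generalize matrixElement (n + 1) (n + 1) (τ / √(2 * ((n + 1 : ℕ) : ℝ))) = A at *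
  rw [show ((n : ℝ) + 1) = ((n + 1 : ℕ) : ℝ) by push_cast; rfl, ← mul_sub, ← mul_assoc, ← h1,
    Complex.ofReal_div] at h
  generalize ((√(2 * ((n + 1 : ℕ) : ℝ)) : ℝ) : ℂ) = w at *
  rw [← h2]
  field_simp at h
  linear_combination -h

theorem hasDerivAt_scaled {N j k : ℕ} (τ : ℝ) {m' : ℂ}
    (h : HasDerivAt (matrixElement j k) m' (τ / √(2 * (N : ℝ)))) :
    HasDerivAt (fun τ : ℝ => matrixElement j k (τ / √(2 * (N : ℝ))))
      (m' / ((√(2 * (N : ℝ)) : ℝ) : ℂ)) τ := by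
  refine (h.scomp τ ((hasDerivAt_id τ).div_const _)).congr_deriv ?_
  rw [Complex.real_smul]
  push_cast
  ring

theorem I_div_sqrt_two : Complex.I / √2 = Complex.I * √2 / 2 := by
  have h0 : (√2 : ℂ) ≠ 0 := by
    rw [Complex.ofReal_ne_zero]; positivity
  rw [div_eq_div_iff h0 two_ne_zero, mul_assoc, sqrt_two_mul_self]

/-- The diagonal commutator identity eliminates the neighbour `m_{N+1,N}` outside the edge block;
the lower element is treated likewise. Thus the equations close on three functions. -/
theorem hasDerivAt_diag_upper (N : ℕ) (t : ℝ) :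
    HasDerivAt (matrixElement N N)
      (Complex.I * (√2 * √(N : ℝ)) * matrixElement N (N - 1) t - t / 2 * matrixElement N N t)
      t := by
  refine (hasDerivAt_matrixElement N N t).congr_deriv ?_
  have h := matrixElement_commutator N N t
  rw [I_div_sqrt_two, matrixElement_comm (N - 1) N]
  linear_combination (-Complex.I / 2) * h + (t : ℂ) * matrixElement N N t / 2 * Complex.I_sq

theorem hasDerivAt_diag_lower {N : ℕ} (hN : N ≠ 0) (t : ℝ) :
    HasDerivAt (matrixElement (N - 1) (N - 1))
      (Complex.I * (√2 * √(N : ℝ)) * matrixElement N (N - 1) t +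
        t / 2 * matrixElement (N - 1) (N - 1) t) t := by
  obtain ⟨n, rfl⟩ := Nat.exists_eq_succ_of_ne_zero hN
  simp only [Nat.succ_eq_add_one, Nat.add_sub_cancel]
  refine (hasDerivAt_matrixElement n n t).congr_deriv ?_
  have h := matrixElement_commutator n n t
  rw [I_div_sqrt_two, matrixElement_comm (n - 1) n]
  push_cast
  linear_combination (Complex.I / 2) * h - (t : ℂ) * matrixElement n n t / 2 * Complex.I_sq

/-- Averaging leaves `τ / (8N)` times the gap of the diagonal elements, itself `τ r / (2N)`: hence
`1 / (16 N²)`. A single diagonal element would have an error of order `1/N`. -/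
theorem hasDerivAt_scaledDiag {N : ℕ} (hN : N ≠ 0) (τ : ℝ) :
    HasDerivAt (scaledDiag N)
      (-((1 - ((1 / (16 * (N : ℝ) ^ 2) : ℝ) : ℂ) * τ ^ 2) * scaledOffDiag N τ)) τ := by
  have h := ((hasDerivAt_scaled (N := N) τ (hasDerivAt_diag_upper N _)).add
    (hasDerivAt_scaled (N := N) τ (hasDerivAt_diag_lower hN _))).div_const 2
  refine h.congr_deriv ?_
  have hσ := sqrt_two_mul_natCast_ne_zero hN
  have h1 := mul_scaledOffDiag hN τ
  have h2 := sq_sqrt_two_mul_natCast N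
  have hN' : (N : ℂ) ≠ 0 := by exact_mod_cast hN
  have h3 : ∀ ε : ℂ, (1 - ε * (τ : ℂ) ^ 2) * scaledOffDiag N τ =
      scaledOffDiag N τ - ε * τ * (τ * scaledOffDiag N τ) := fun ε => by ring
  rw [← sqrt_two_mul_natCast, h3, h1, scaledOffDiag, Complex.ofReal_div]
  generalize matrixElement N (N - 1) (τ / √(2 * (N : ℝ))) = c at *
  generalize matrixElement N N (τ / √(2 * (N : ℝ))) = A at *
  generalize matrixElement (N - 1) (N - 1) (τ / √(2 * (N : ℝ))) = B at *
  generalize ((√(2 * (N : ℝ)) : ℝ) : ℂ) = w at *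
  have hw : (N : ℂ) = w ^ 2 / 2 := by rw [h2]; ring
  push_cast
  rw [hw]
  field_simp
  ring

theorem hasDerivAt_mul_scaledOffDiag {N : ℕ} (hN : N ≠ 0) (τ : ℝ) :
    HasDerivAt (fun τ : ℝ => (τ : ℂ) * scaledOffDiag N τ) (τ * scaledDiag N τ) τ := by
  have h := ((hasDerivAt_scaled (N := N) τ (hasDerivAt_diag_lower hN _)).sub
    (hasDerivAt_scaled (N := N) τ (hasDerivAt_diag_upper N _))).const_mul (2 * (N : ℂ))
  refine (h.congr_deriv ?_).congr_of_eventuallyEq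
    (Eventually.of_forall fun t => mul_scaledOffDiag hN t)
  have hσ := sqrt_two_mul_natCast_ne_zero hN
  have h2 := sq_sqrt_two_mul_natCast N
  rw [← h2, scaledDiag, Complex.ofReal_div]
  field_simp
  ring

theorem average_expSum_scaled {N : ℕ} (hN : N ≠ 0) {τ : ℝ} (hτ : τ ≠ 0) :
    (1 / (N : ℂ)) * average N (expSum N (τ / √(2 * (N : ℝ)))) = 2 * scaledOffDiag N τ / τ := by
  have h := mul_traceElement N (τ / √(2 * (N : ℝ)))
  have hσ := sqrt_two_mul_natCast_ne_zero hN
  have h2 := sq_sqrt_two_mul_natCast N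
  have hN' : (N : ℂ) ≠ 0 := by exact_mod_cast hN
  have hτ' : (τ : ℂ) ≠ 0 := by exact_mod_cast hτ
  rw [average_expSum, scaledOffDiag]
  rw [← mul_assoc, ← sqrt_two_mul_natCast, Complex.ofReal_div] at h
  generalize traceElement N (τ / √(2 * (N : ℝ))) = T at *
  generalize matrixElement N (N - 1) (τ / √(2 * (N : ℝ))) = c at *
  generalize ((√(2 * (N : ℝ)) : ℝ) : ℂ) = w at *
  field_simp at h ⊢
  linear_combination (-Complex.I) * h - Complex.I * c * h2 + τ * T * Complex.I_sq

/-- The covariance of two exponential sums, on the scale of the spectrum. -/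
noncomputable def scaledCov (N : ℕ) (τ₁ τ₂ : ℝ) : ℂ :=
  covKernel N (τ₁ / √(2 * (N : ℝ))) (τ₂ / √(2 * (N : ℝ)))

theorem scaledCov_zero_right (N : ℕ) (τ : ℝ) : scaledCov N τ 0 = 0 := by
  rw [scaledCov, zero_div, covKernel_zero_right]

theorem continuous_scaledCov_left (N : ℕ) (τ₂ : ℝ) : Continuous fun τ₁ => scaledCov N τ₁ τ₂ :=
  (continuous_covKernel_left N _).comp (continuous_id.div_const _)

/-- Writing the diagonal elements as `p` minus and plus half their gap, the products of gaps cancel,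
so no error term appears. -/
theorem hasDerivAt_mul_scaledCov {N : ℕ} (hN : N ≠ 0) (s u : ℝ) :
    HasDerivAt (fun u => (s : ℂ) * scaledCov N (s - u) u)
      ((scaledDiag N (s - u) * (u * scaledOffDiag N u) -
        ((s - u : ℝ) * scaledOffDiag N (s - u)) * scaledDiag N u) / 2) u := by
  have hσ := sqrt_two_mul_natCast_ne_zero hN
  have h := ((hasDerivAt_mul_covKernel N (s / √(2 * (N : ℝ))) (u / √(2 * (N : ℝ)))).scomp u
    ((hasDerivAt_id u).div_const (√(2 * (N : ℝ))))).const_mul ((√(2 * (N : ℝ)) : ℝ) : ℂ)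
  refine (h.congr_deriv ?_).congr_of_eventuallyEq (Eventually.of_forall fun y => ?_)
  · rw [mul_scaledOffDiag hN, mul_scaledOffDiag hN, scaledDiag, scaledDiag, Complex.real_smul,
      ← sub_div]
    push_cast
    field_simp
    ring
  · simp only [Function.comp, id]
    rw [scaledCov, ← sub_div]
    push_cast
    field_simp

end GUE

/-! ### Solving the first-order equation for the covariance -/

/-- The combination `τ₁ τ₂ (p (τ₁) r (τ₂) + p (τ₂) r (τ₁)) / 2`. -/
noncomputable def symmetricPair (p r : ℝ → ℂ) (τ₁ τ₂ : ℝ) : ℂ :=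
  (τ₁ * p τ₁ * (τ₂ * r τ₂) + τ₂ * p τ₂ * (τ₁ * r τ₁)) / 2

theorem hasDerivAt_mul_of_bessel_system {p r : ℝ → ℂ} {ε : ℝ}
    (hp : ∀ t : ℝ, HasDerivAt p (-((1 - ε * t ^ 2) * r t)) t) (t : ℝ) :
    HasDerivAt (fun t : ℝ => (t : ℂ) * p t) (p t - t * ((1 - ε * t ^ 2) * r t)) t := by
  have h : HasDerivAt (fun t : ℝ => (t : ℂ)) 1 t := Complex.ofRealCLM.hasDerivAt
  refine (h.mul (hp t)).congr_deriv ?_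
  ring

/-- For `ε = 0` the sum is constant along `τ₁ + τ₂ = s` and vanishes at `u = 0`. In general its
derivative carries `ε ((s - u)² - u²) = ε s (s - 2u)`; the factor `s` permits division by `s`
uniformly near `0`. -/
theorem norm_mul_add_symmetricPair_le {p r : ℝ → ℂ} {ε : ℝ} (hε : 0 ≤ ε)
    (hp : ∀ t : ℝ, HasDerivAt p (-((1 - ε * t ^ 2) * r t)) t)
    (hr : ∀ t : ℝ, HasDerivAt (fun t : ℝ => t * r t) (t * p t) t)
    (hr1 : ∀ t, ‖r t‖ ≤ 1) {C : ℝ → ℝ → ℂ}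
    (hC : ∀ s u : ℝ, HasDerivAt (fun u => (s : ℂ) * C (s - u) u)
      ((p (s - u) * (u * r u) - ((s - u : ℝ) * r (s - u)) * p u) / 2) u)
    (hC0 : ∀ t, C t 0 = 0) (s b : ℝ) :
    ‖s * C (s - b) b + symmetricPair p r (s - b) b‖ ≤
      ε / 2 * |s| * (|s| + |b|) * |b| * (|s| + 2 * |b|) * |b| := by
  set Φ : ℝ → ℂ := fun u => s * C (s - u) u + symmetricPair p r (s - u) u with hΦ
  have hΦ' : ∀ u : ℝ, HasDerivAt Φ (-(((ε / 2 * ((s - u) * u * (s * (s - 2 * u))) : ℝ) : ℂ) *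
      (r (s - u) * r u))) u := by
    intro u
    have h1 := GUE.hasDerivAt_comp_sub (s := s) (hasDerivAt_mul_of_bessel_system hp (s - u))
    have h2 := GUE.hasDerivAt_comp_sub (s := s) (hr (s - u))
    have h3 := (((h1.mul (hr u)).add ((hasDerivAt_mul_of_bessel_system hp u).mul h2)).div_const 2)
    refine ((hC s u).add h3).congr_deriv ?_
    push_cast
    ring
  have hseg : ∀ u ∈ Set.uIcc 0 b, |u| ≤ |b| := by
    intro u hu
    have := Set.abs_sub_left_of_mem_uIcc hu
    simpa using this
  have h0 : Φ 0 = 0 := by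
    simp [hΦ, hC0, symmetricPair]
  have hmain := Convex.norm_image_sub_le_of_norm_hasDerivWithin_le (f := Φ)
    (C := ε / 2 * |s| * (|s| + |b|) * |b| * (|s| + 2 * |b|))
    (fun u _ => (hΦ' u).hasDerivWithinAt) (fun u hu => ?_) (convex_uIcc 0 b)
    Set.left_mem_uIcc Set.right_mem_uIcc
  · rw [h0, sub_zero, sub_zero, Real.norm_eq_abs] at hmain
    exact hmain
  · have hu' := hseg u hu
    have h1 : |s - u| ≤ |s| + |b| := (abs_sub _ _).trans (by linarith)
    have h2 : |s - 2 * u| ≤ |s| + 2 * |b| := by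
      refine (abs_sub _ _).trans ?_
      rw [abs_mul, abs_two]
      linarith
    rw [norm_neg, norm_mul, norm_mul, Complex.norm_real, Real.norm_eq_abs]
    simp only [abs_mul]
    rw [abs_of_nonneg (by positivity : 0 ≤ ε / 2)]
    calc ε / 2 * (|s - u| * |u| * (|s| * |s - 2 * u|)) * (‖r (s - u)‖ * ‖r u‖)
        ≤ ε / 2 * ((|s| + |b|) * |b| * (|s| * (|s| + 2 * |b|))) * (1 * 1) := by
          gcongr
          exacts [hr1 _, hr1 _]
      _ = _ := by ring

theorem norm_add_symmetricPair_div_le {p r : ℝ → ℂ} {ε : ℝ} (hε : 0 ≤ ε)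
    (hp : ∀ t : ℝ, HasDerivAt p (-((1 - ε * t ^ 2) * r t)) t)
    (hr : ∀ t : ℝ, HasDerivAt (fun t : ℝ => t * r t) (t * p t) t)
    (hr1 : ∀ t, ‖r t‖ ≤ 1) {C : ℝ → ℝ → ℂ}
    (hC : ∀ s u : ℝ, HasDerivAt (fun u => (s : ℂ) * C (s - u) u)
      ((p (s - u) * (u * r u) - ((s - u : ℝ) * r (s - u)) * p u) / 2) u)
    (hC0 : ∀ t, C t 0 = 0) {s : ℝ} (hs : s ≠ 0) (b : ℝ) :
    ‖C (s - b) b + symmetricPair p r (s - b) b / s‖ ≤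
      ε / 2 * (|s| + |b|) * |b| * (|s| + 2 * |b|) * |b| := by
  have h := norm_mul_add_symmetricPair_le hε hp hr hr1 hC hC0 s b
  have hs' : (s : ℂ) ≠ 0 := by exact_mod_cast hs
  have h1 : (s : ℂ) * C (s - b) b + symmetricPair p r (s - b) b =
      s * (C (s - b) b + symmetricPair p r (s - b) b / s) := by field_simp
  rw [h1, norm_mul, Complex.norm_real, Real.norm_eq_abs] at h
  refine le_of_mul_le_mul_left (h.trans (le_of_eq ?_)) (abs_pos.2 hs)
  ring

theorem norm_add_diagonal_le {p r : ℝ → ℂ} {ε : ℝ} (hε : 0 ≤ ε)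
    (hp : ∀ t : ℝ, HasDerivAt p (-((1 - ε * t ^ 2) * r t)) t)
    (hr : ∀ t : ℝ, HasDerivAt (fun t : ℝ => t * r t) (t * p t) t)
    (hr1 : ∀ t, ‖r t‖ ≤ 1) {C : ℝ → ℝ → ℂ}
    (hC : ∀ s u : ℝ, HasDerivAt (fun u => (s : ℂ) * C (s - u) u)
      ((p (s - u) * (u * r u) - ((s - u : ℝ) * r (s - u)) * p u) / 2) u)
    (hC0 : ∀ t, C t 0 = 0) (hCc : ∀ b, Continuous fun a => C a b) (τ : ℝ) :
    ‖C τ (-τ) + ((p τ - τ * ((1 - ε * τ ^ 2) * r τ)) * (-τ * r (-τ)) +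
      -τ * p (-τ) * (τ * p τ)) / 2‖ ≤ ε * τ ^ 4 := by
  -- At `s = 0` the bound itself is zero, so no parity of `p` and `r` is needed. The quotient by `s`
  -- therefore tends to a derivative.
  have hzero : symmetricPair p r τ (-τ) = 0 := by
    have h := norm_mul_add_symmetricPair_le hε hp hr hr1 hC hC0 0 (-τ)
    simpa using h
  have hder : HasDerivAt (fun a => symmetricPair p r a (-τ))
      (((p τ - τ * ((1 - ε * τ ^ 2) * r τ)) * (-τ * r (-τ)) +
        -τ * p (-τ) * (τ * p τ)) / 2) τ := by
    have h := (((hasDerivAt_mul_of_bessel_system hp τ).mul_const (((-τ : ℝ) : ℂ) * r (-τ))).add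
      ((hr τ).const_mul (((-τ : ℝ) : ℂ) * p (-τ)))).div_const 2
    refine h.congr_deriv ?_
    push_cast
    ring
  have hslope := hder.tendsto_slope_zero
  simp only [hzero, sub_zero] at hslope
  have hcont : Tendsto (fun s : ℝ => C (τ + s) (-τ)) (𝓝[≠] 0) (𝓝 (C τ (-τ))) := by
    have h : Continuous fun s : ℝ => C (τ + s) (-τ) :=
      (hCc (-τ)).comp (continuous_const.add continuous_id)
    have h2 := h.tendsto 0
    rw [add_zero] at h2
    exact h2.mono_left nhdsWithin_le_nhds
  have hbd : Tendsto (fun s : ℝ => ε / 2 * (|s| + |-τ|) * |-τ| * (|s| + 2 * |-τ|) * |-τ|)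
      (𝓝[≠] 0) (𝓝 (ε * τ ^ 4)) := by
    have h : Continuous fun s : ℝ => ε / 2 * (|s| + |-τ|) * |-τ| * (|s| + 2 * |-τ|) * |-τ| := by
      fun_prop
    have h2 := h.tendsto 0
    have h3 : ε / 2 * (|(0 : ℝ)| + |-τ|) * |-τ| * (|(0 : ℝ)| + 2 * |-τ|) * |-τ| = ε * τ ^ 4 := by
      rw [abs_zero, abs_neg, zero_add, zero_add, show τ ^ 4 = (τ ^ 2) ^ 2 by ring, ← sq_abs τ]
      ring
    rw [h3] at h2
    exact h2.mono_left nhdsWithin_le_nhds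
  refine le_of_tendsto_of_tendsto (hcont.add hslope).norm hbd ?_
  filter_upwards [self_mem_nhdsWithin] with s hs
  have h := norm_add_symmetricPair_div_le hε hp hr hr1 hC hC0 hs (-τ)
  rw [sub_neg_eq_add, add_comm s τ] at h
  rw [Complex.real_smul, Complex.ofReal_inv, ← div_eq_inv_mul]
  exact h

/-! ### Products of asymptotic expansions -/

theorem isBigO_mul_sub_mul {f g : ℕ → ℂ} {a b : ℂ} {h : ℕ → ℝ}
    (hf : (fun n => f n - a) =O[atTop] h) (hg : (fun n => g n - b) =O[atTop] h)
    (hg1 : ∀ n, ‖g n‖ ≤ 1) : (fun n => f n * g n - a * b) =O[atTop] h := by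
  have h1 : g =O[atTop] fun _ => (1 : ℝ) :=
    IsBigO.of_bound 1 (Eventually.of_forall fun n => by simpa using hg1 n)
  have h2 := hf.mul h1
  simp only [mul_one] at h2
  refine (h2.add (hg.const_mul_left a)).congr_left fun n => ?_
  ring

theorem isBigO_one_div_sq_of_le {f : ℕ → ℂ} {K : ℝ}
    (h : ∀ N : ℕ, N ≠ 0 → ‖f N‖ ≤ 1 / (16 * (N : ℝ) ^ 2) * K) :
    f =O[atTop] fun N : ℕ => 1 / (N : ℝ) ^ 2 := by
  refine IsBigO.of_bound (K / 16) ?_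
  filter_upwards [eventually_ne_atTop 0] with N hN
  refine (h N hN).trans (le_of_eq ?_)
  have hN' : (N : ℝ) ≠ 0 := by exact_mod_cast hN
  rw [Real.norm_of_nonneg (by positivity)]
  field_simp

theorem tendsto_of_isBigO_one_div_sq {E : Type*} [NormedAddCommGroup E] {f : ℕ → E} {a : E}
    (h : (fun n => f n - a) =O[atTop] fun N : ℕ => 1 / (N : ℝ) ^ 2) :
    Tendsto f atTop (𝓝 a) := by
  have h1 : Tendsto (fun N : ℕ => 1 / (N : ℝ) ^ 2) atTop (𝓝 0) := by
    have := (tendsto_one_div_atTop_nhds_zero_nat (𝕜 := ℝ)).pow 2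
    simpa using this
  exact tendsto_sub_nhds_zero_iff.1 (h.trans_tendsto h1)

/-! ### Convergence rates for the mean, the covariance and the structure function -/

namespace GUE

theorem norm_scaled_sub_besselJ_le {N : ℕ} (hN : N ≠ 0) (τ : ℝ) :
    ‖scaledDiag N τ - besselJ 0 τ‖ ≤ 2 * (1 / (16 * (N : ℝ) ^ 2)) * |τ| ^ 3 ∧
      ‖scaledOffDiag N τ - besselJ 1 τ‖ ≤ 2 * (1 / (16 * (N : ℝ) ^ 2)) * |τ| ^ 3 :=
  norm_sub_besselJ_le (by positivity) (hasDerivAt_scaledDiag hN) (hasDerivAt_mul_scaledOffDiag hN)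
    (continuous_scaledOffDiag N) (scaledDiag_zero N) (scaledOffDiag_zero hN)
    (norm_scaledOffDiag_le N) τ

theorem isBigO_scaledDiag (τ : ℝ) :
    (fun N : ℕ => scaledDiag N τ - besselJ 0 τ) =O[atTop] fun N : ℕ => 1 / (N : ℝ) ^ 2 :=
  isBigO_one_div_sq_of_le (K := 2 * |τ| ^ 3) fun _ hN =>
    (norm_scaled_sub_besselJ_le hN τ).1.trans (le_of_eq (by ring))

theorem isBigO_scaledOffDiag (τ : ℝ) :
    (fun N : ℕ => scaledOffDiag N τ - besselJ 1 τ) =O[atTop] fun N : ℕ => 1 / (N : ℝ) ^ 2 :=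
  isBigO_one_div_sq_of_le (K := 2 * |τ| ^ 3) fun _ hN =>
    (norm_scaled_sub_besselJ_le hN τ).2.trans (le_of_eq (by ring))

theorem isBigO_mean {τ : ℝ} (hτ : τ ≠ 0) :
    (fun N : ℕ => (1 / (N : ℂ)) * average N (expSum N (τ / √(2 * (N : ℝ)))) -
      ((2 * besselJ 1 τ / τ : ℝ) : ℂ)) =O[atTop] fun N : ℕ => 1 / (N : ℝ) ^ 2 := by
  refine ((isBigO_scaledOffDiag τ).const_mul_left (2 / (τ : ℂ))).congr' ?_ EventuallyEq.rfl
  filter_upwards [eventually_ne_atTop 0] with N hN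
  rw [average_expSum_scaled hN hτ]
  push_cast
  ring

theorem isBigO_cov {τ₁ τ₂ : ℝ} (h : τ₁ + τ₂ ≠ 0) :
    (fun N : ℕ => cov N (expSum N (τ₁ / √(2 * (N : ℝ)))) (expSum N (τ₂ / √(2 * (N : ℝ)))) -
      ((-(τ₁ * τ₂ / (2 * (τ₁ + τ₂))) *
        (besselJ 0 τ₁ * besselJ 1 τ₂ + besselJ 1 τ₁ * besselJ 0 τ₂) : ℝ) : ℂ))
      =O[atTop] fun N : ℕ => 1 / (N : ℝ) ^ 2 := by
  have h1 : (fun N : ℕ => scaledCov N τ₁ τ₂ +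
      symmetricPair (scaledDiag N) (scaledOffDiag N) τ₁ τ₂ / ((τ₁ + τ₂ : ℝ) : ℂ))
      =O[atTop] fun N : ℕ => 1 / (N : ℝ) ^ 2 := by
    refine isBigO_one_div_sq_of_le
      (K := (|τ₁ + τ₂| + |τ₂|) * |τ₂| * (|τ₁ + τ₂| + 2 * |τ₂|) * |τ₂| / 2) fun N hN => ?_
    have h2 := norm_add_symmetricPair_div_le (ε := 1 / (16 * (N : ℝ) ^ 2)) (by positivity)
      (hasDerivAt_scaledDiag hN) (hasDerivAt_mul_scaledOffDiag hN) (norm_scaledOffDiag_le N)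
      (hasDerivAt_mul_scaledCov hN) (scaledCov_zero_right N) h τ₂
    rw [add_sub_cancel_right] at h2
    exact h2.trans (le_of_eq (by ring))
  have h2 := isBigO_mul_sub_mul (isBigO_scaledDiag τ₁) (isBigO_scaledOffDiag τ₂)
    fun N => norm_scaledOffDiag_le N τ₂
  have h3 := isBigO_mul_sub_mul (isBigO_scaledDiag τ₂) (isBigO_scaledOffDiag τ₁)
    fun N => norm_scaledOffDiag_le N τ₁
  refine (h1.sub ((h2.add h3).const_mul_left
    ((τ₁ : ℂ) * τ₂ / (2 * (τ₁ + τ₂))))).congr_left fun N => ?_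
  have h' : (τ₁ : ℂ) + τ₂ ≠ 0 := by exact_mod_cast h
  rw [cov_expSum, scaledCov, covKernel, symmetricPair]
  push_cast
  field_simp
  ring

theorem isBigO_structureFunction {τ : ℝ} (hτ : τ ≠ 0) :
    (fun N : ℕ => structureFunction N (τ / √(2 * (N : ℝ))) -
      τ ^ 2 / 2 * (besselJ 0 τ ^ 2 + besselJ 1 τ ^ 2 - besselJ 0 τ * besselJ 1 τ / τ))
      =O[atTop] fun N : ℕ => 1 / (N : ℝ) ^ 2 := by
  have h1 : (fun N : ℕ => scaledCov N τ (-τ) + ((scaledDiag N τ - τ * scaledOffDiag N τ) *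
      (-τ * scaledOffDiag N (-τ)) + -τ * scaledDiag N (-τ) * (τ * scaledDiag N τ)) / 2)
      =O[atTop] fun N : ℕ => 1 / (N : ℝ) ^ 2 := by
    refine isBigO_one_div_sq_of_le (K := τ ^ 4 + |τ| ^ 4 / 2) fun N hN => ?_
    have h2 := norm_add_diagonal_le (ε := 1 / (16 * (N : ℝ) ^ 2)) (by positivity)
      (hasDerivAt_scaledDiag hN) (hasDerivAt_mul_scaledOffDiag hN) (norm_scaledOffDiag_le N)
      (hasDerivAt_mul_scaledCov hN) (scaledCov_zero_right N) (continuous_scaledCov_left N) τ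
    set ε : ℝ := 1 / (16 * (N : ℝ) ^ 2) with hε
    have hε0 : 0 ≤ ε := by positivity
    -- This is the contribution of `ε τ²` in the factor `1 - ε τ²`; it is moved into the error.
    have h3 : ‖((ε / 2 * τ ^ 4 : ℝ) : ℂ) * (scaledOffDiag N τ * scaledOffDiag N (-τ))‖ ≤
        ε / 2 * |τ| ^ 4 := by
      rw [norm_mul, norm_mul, Complex.norm_real, Real.norm_eq_abs, abs_mul, abs_pow,
        abs_of_nonneg (by positivity : 0 ≤ ε / 2)]
      calc ε / 2 * |τ| ^ 4 * (‖scaledOffDiag N τ‖ * ‖scaledOffDiag N (-τ)‖)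
          ≤ ε / 2 * |τ| ^ 4 * (1 * 1) := by
            gcongr
            exacts [norm_scaledOffDiag_le _ _, norm_scaledOffDiag_le _ _]
        _ = _ := by ring
    refine le_trans (le_of_eq (congrArg norm ?_)) ((norm_add_le _ _).trans
      ((add_le_add h2 h3).trans (le_of_eq (by ring))))
    push_cast
    ring
  have h2 := isBigO_mul_sub_mul (isBigO_scaledDiag τ) (isBigO_scaledOffDiag (-τ))
    fun N => norm_scaledOffDiag_le N (-τ)
  have h3 := isBigO_mul_sub_mul (isBigO_scaledOffDiag τ) (isBigO_scaledOffDiag (-τ))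
    fun N => norm_scaledOffDiag_le N (-τ)
  have h4 := isBigO_mul_sub_mul (isBigO_scaledDiag (-τ)) (isBigO_scaledDiag τ)
    fun N => norm_scaledDiag_le N τ
  rw [besselJ_one_neg] at h2 h3
  rw [besselJ_zero_neg] at h4
  have h5 := ((h1.add (h2.const_mul_left ((τ : ℂ) / 2))).sub
    (h3.const_mul_left ((τ : ℂ) ^ 2 / 2))).add (h4.const_mul_left ((τ : ℂ) ^ 2 / 2))
  refine Complex.isBigO_ofReal_left.1 (h5.congr_left fun N => ?_)
  have hτ' : (τ : ℂ) ≠ 0 := by exact_mod_cast hτ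
  have h6 := structureFunction_eq_cov N (τ / √(2 * (N : ℝ)))
  rw [cov_expSum, ← neg_div] at h6
  rw [Complex.ofReal_sub, h6, scaledCov, covKernel]
  push_cast
  field_simp
  ring

end GUE

theorem mainTheorem6 :
    (∀ τ : ℝ, τ ≠ 0 →
      Tendsto (fun N : ℕ => (1 / (N : ℂ)) * GUE.average N (GUE.expSum N (τ / √(2 * (N : ℝ)))))
        atTop (𝓝 ((2 * besselJ 1 τ / τ : ℝ) : ℂ)) ∧
      (fun N : ℕ => (1 / (N : ℂ)) * GUE.average N (GUE.expSum N (τ / √(2 * (N : ℝ)))) -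
          ((2 * besselJ 1 τ / τ : ℝ) : ℂ))
        =O[atTop] fun N : ℕ => 1 / (N : ℝ) ^ 2) ∧
    (∀ τ : ℝ, τ ≠ 0 →
      Tendsto (fun N : ℕ => GUE.structureFunction N (τ / √(2 * (N : ℝ)))) atTop
        (𝓝 (τ ^ 2 / 2 *
          (besselJ 0 τ ^ 2 + besselJ 1 τ ^ 2 - besselJ 0 τ * besselJ 1 τ / τ))) ∧
      (fun N : ℕ => GUE.structureFunction N (τ / √(2 * (N : ℝ))) -
          τ ^ 2 / 2 * (besselJ 0 τ ^ 2 + besselJ 1 τ ^ 2 - besselJ 0 τ * besselJ 1 τ / τ))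
        =O[atTop] fun N : ℕ => 1 / (N : ℝ) ^ 2) ∧
    (∀ τ₁ τ₂ : ℝ, τ₁ + τ₂ ≠ 0 →
      Tendsto (fun N : ℕ => GUE.cov N (GUE.expSum N (τ₁ / √(2 * (N : ℝ))))
          (GUE.expSum N (τ₂ / √(2 * (N : ℝ)))))
        atTop
        (𝓝 ((-(τ₁ * τ₂ / (2 * (τ₁ + τ₂))) *
          (besselJ 0 τ₁ * besselJ 1 τ₂ + besselJ 1 τ₁ * besselJ 0 τ₂) : ℝ) : ℂ)) ∧
      (fun N : ℕ => GUE.cov N (GUE.expSum N (τ₁ / √(2 * (N : ℝ))))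
          (GUE.expSum N (τ₂ / √(2 * (N : ℝ)))) -
          ((-(τ₁ * τ₂ / (2 * (τ₁ + τ₂))) *
            (besselJ 0 τ₁ * besselJ 1 τ₂ + besselJ 1 τ₁ * besselJ 0 τ₂) : ℝ) : ℂ))
        =O[atTop] fun N : ℕ => 1 / (N : ℝ) ^ 2) := by
  exact ⟨fun τ hτ => ⟨tendsto_of_isBigO_one_div_sq (GUE.isBigO_mean hτ), GUE.isBigO_mean hτ⟩,
    fun τ hτ => ⟨tendsto_of_isBigO_one_div_sq (GUE.isBigO_structureFunction hτ),
      GUE.isBigO_structureFunction hτ⟩,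
    fun τ₁ τ₂ h => ⟨tendsto_of_isBigO_one_div_sq (GUE.isBigO_cov h), GUE.isBigO_cov h⟩⟩
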